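/- Work on the unit sphere $S^2\subset\mathbb{R}^3$ with the spherical distance $|ab|=\arccos\langle a,b\rangle$. A set $C\subseteq S^2$ is convex if any two of its points $a,b$ satisfy $|ab|<\pi$ and the shorter great-circle arc joining them lies in $C$; a convex body is a closed convex set with non-empty interior. A spherical polygon is the convex hull (the intersection of all convex sets containing them) of finitely many, at least three, points that lie in a common convex set and none of which belongs to the convex hull of the others. A lune is the intersection of two different hemispheres (closed disks of radius $\pi/2$) $G,H$ whose centers are not antipodal; its thickness is the distance between the midpoints of the two half great circles $\mathrm{bd}(G)\cap H$ and $\mathrm{bd}(H)\cap G$ that bound it. The thickness $\Delta(C)$ of a convex body $C$ is the minimal thickness of a lune containing $C$, and $C$ is reduced if $\Delta(R)<\Delta(C)$ for every convex body $R\subsetneq C$. The diameter $\mathrm{diam}(C)$ is the supremum of $|ab|$ over $a,b\in C$. Proposition. For every reduced spherical polygon $V$ of thickness $\Delta(V)\le\frac{\pi}{2}$, $$\mathrm{diam}(V)\le\arccos\Big(\cos\Delta(V)\,\sqrt{1-\tfrac{\sqrt2}{2}\sin\Delta(V)}\Big),$$ and equality holds if and only if $\Delta(V)=\frac{\pi}{2}$.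 -/

import Mathlib

namespace SphericalPolygon

/-- The unit sphere `S²` of Euclidean 3-space. -/
abbrev S2 : Type := Metric.sphere (0 : EuclideanSpace ℝ (Fin 3)) 1

/-- Spherical distance `|ab|`: the length of a shortest arc of a great circle from `a` to `b`. -/
noncomputable def sdist (a b : S2) : ℝ :=
  InnerProductGeometry.angle (a : EuclideanSpace ℝ (Fin 3)) (b : EuclideanSpace ℝ (Fin 3))

/-- The arc `ab`, the shorter part of the great circle through `a` and `b` (for `b ≠ -a`):
the points of the sphere that are combinations of `a` and `b` with nonnegative coefficients.
For `a = b` it is the one-point set `{a}`. -/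
def arc (a b : S2) : Set S2 :=
  {x | ∃ s t : ℝ, 0 ≤ s ∧ 0 ≤ t ∧
    (x : EuclideanSpace ℝ (Fin 3)) =
      s • (a : EuclideanSpace ℝ (Fin 3)) + t • (b : EuclideanSpace ℝ (Fin 3))}

/-- Spherical convexity: any two points are at distance less than `π` and the arc that joins them
stays in the set. -/
def IsConvex (C : Set S2) : Prop :=
  ∀ a ∈ C, ∀ b ∈ C, sdist a b < Real.pi ∧ arc a b ⊆ C

/-- A convex body: a closed convex set with nonempty interior (in `S²`). -/
def IsConvexBody (C : Set S2) : Prop :=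
  IsClosed C ∧ IsConvex C ∧ (interior C).Nonempty

/-- The convex hull: the intersection of all convex sets that contain `A`. It is used only for
sets `A` that are contained in some convex set. -/
def hull (A : Set S2) : Set S2 :=
  ⋂₀ {D | IsConvex D ∧ A ⊆ D}

/-- A spherically convex polygon: the convex hull of finitely many, at least three, points (all
contained in some convex set), none of which lies in the convex hull of the others. -/
def IsPolygon (V : Set S2) : Prop :=
  ∃ P : Finset S2, 3 ≤ P.card ∧ (∃ D : Set S2, IsConvex D ∧ (P : Set S2) ⊆ D) ∧
    (∀ p ∈ P, p ∉ hull ((P : Set S2) \ {p})) ∧ V = hull (P : Set S2)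

/-- The (closed) hemisphere with center `c`. -/
def hemisphere (c : S2) : Set S2 :=
  {x | sdist c x ≤ Real.pi / 2}

/-- `G/H` for the hemispheres `G`, `H` with centers `c`, `d`: the part of the boundary circle of
`G` that is contained in `G ∩ H`. -/
def luneSide (c d : S2) : Set S2 :=
  {x | sdist c x = Real.pi / 2 ∧ x ∈ hemisphere c ∩ hemisphere d}

/-- `p` is the center (midpoint) of the half great circle `A`: the only point of `A`
from which every point of `A` has distance at most `π / 2`. -/
def IsSemicircleCenter (p : S2) (A : Set S2) : Prop :=
  p ∈ A ∧ ∀ q ∈ A, sdist p q ≤ Real.pi / 2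

/-- `L` is a lune of thickness `δ`: the intersection of two different hemispheres `G`, `H` whose
centers are not antipodes, with `δ` the distance between the centers of `G/H` and `H/G`. -/
def IsLuneOfThickness (L : Set S2) (δ : ℝ) : Prop :=
  ∃ c d : S2, c ≠ d ∧ c ≠ -d ∧ L = hemisphere c ∩ hemisphere d ∧
    ∃ p q : S2, IsSemicircleCenter p (luneSide c d) ∧ IsSemicircleCenter q (luneSide d c) ∧
      δ = sdist p q

/-- The thickness `Δ(C)`: the least thickness of a lune that contains `C`
(for a convex body such lunes exist, and by compactness the infimum is attained). -/
noncomputable def thickness (C : Set S2) : ℝ :=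
  sInf {δ | ∃ L : Set S2, IsLuneOfThickness L δ ∧ C ⊆ L}

/-- A convex body is reduced if every convex body properly contained in it has smaller
thickness. -/
def IsReduced (C : Set S2) : Prop :=
  IsConvexBody C ∧ ∀ R : Set S2, IsConvexBody R → R ⊂ C → thickness R < thickness C

/-- The diameter: the supremum of the spherical distances of pairs of points of `C`. -/
noncomputable def diam (C : Set S2) : ℝ :=
  sSup (Set.image2 sdist C C)

end SphericalPolygon

/-! Put `C = cos Δ`, `S = sin Δ` for the thickness `Δ` of the polygon, and replace the polygon by
the cone it spans. A lune containing it is a pair of unit vectors `c`, `d` of the polar cone, with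
thickness `arccos (-⟪c, d⟫)`; so `⟪c, d⟫ ≥ -C` on unit vectors of the polar cone. A pair attaining
the bound gives a `Chord`: the centers `p`, `q` of the two sides of the lune lie in the polygon, at
distance `Δ`.

Reducedness gives a chord ending at every vertex `w`: a body trimmed near `w` is thinner, so its
best lune excludes `w` and touches it close to `w`; these lunes converge as the trimming shrinks
(`exists_pair_cutoff`, `exists_limit_pair`, `exists_chord`).

Let `Δ < π / 2`. Any two chords cross (`Chord.crossing`), so non-coplanar ones are related by a
rotation (`Ord`). Tilting both hemispheres of a thinnest lune cannot make it thinner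
(`Chord.second_variation`); hence neighbouring chords `a`, `b` have bottoms `a.p`, `b.p` as far
apart as their tops `a.q`, `b.q` (`Ord.base`). Inserting chords between two arbitrary ones, and
comparing convex paths one inside the other, gives `|a.p b.p| ≤ |a.q A| + |A b.q|`, where the apex
`A` is the intersection of the circles supporting the polygon at the tops (`Ord.angle_le`). Doubling
the longer leg and using coordinates adapted to its chord, this becomes an inequality between real
numbers (`false_of_bounds`), which yields a strict bound for the distance of two vertices
(`inner_gt`). A nonnegative lower bound for inner products of vertices passes to the whole hull, so
the diameter bound is strict.

If `Δ = π / 2`, then `d = p` in every chord: the polygon lies within `π / 2` of each vertex, and a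
chord realizes this distance. -/

open scoped RealInnerProductSpace

/-! ### Determinants in three-space and the metric relations in a chord. -/

namespace SphericalPolygon

/-- Euclidean 3-space. -/
abbrev E3 : Type := EuclideanSpace ℝ (Fin 3)

theorem inner_coord (x y : E3) : ⟪x, y⟫ = x 0 * y 0 + x 1 * y 1 + x 2 * y 2 := by
  simp [PiLp.inner_apply, Fin.sum_univ_three, mul_comm]

/-- The determinant of three vectors, scaled by an orientation factor `τ`. -/
def tdet (τ : ℝ) (x y z : E3) : ℝ :=
  τ * (x 0 * (y 1 * z 2 - y 2 * z 1) + x 1 * (y 2 * z 0 - y 0 * z 2)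
    + x 2 * (y 0 * z 1 - y 1 * z 0))

/-- The cross product. -/
def cross (x y : E3) : E3 :=
  !₂[x 1 * y 2 - x 2 * y 1, x 2 * y 0 - x 0 * y 2, x 0 * y 1 - x 1 * y 0]

theorem inner_cross (τ : ℝ) (x y z : E3) : ⟪τ • cross x y, z⟫ = tdet τ x y z := by
  simp [inner_coord, cross, tdet]; ring

theorem inner_cross_cross (x y z w : E3) :
    ⟪cross x y, cross z w⟫ = ⟪x, z⟫ * ⟪y, w⟫ - ⟪x, w⟫ * ⟪y, z⟫ := by
  simp [inner_coord, cross]; ring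

/-- Four vectors of three-space satisfy a linear relation whose coefficients are their determinants;
here it is tested against `d`. Most sign comparisons of determinants rest on it. -/
theorem plucker (τ : ℝ) (d q y z p : E3) :
    tdet τ y z p * ⟪d, q⟫ - tdet τ q z p * ⟪d, y⟫ + tdet τ q y p * ⟪d, z⟫
      - tdet τ q y z * ⟪d, p⟫ = 0 := by
  simp only [inner_coord, tdet]; ring

theorem tdet_rot (τ : ℝ) (x y z : E3) : tdet τ x y z = tdet τ y z x := by
  simp only [tdet]; ring

theorem tdet_swap (τ : ℝ) (x y z : E3) : tdet τ x y z = - tdet τ y x z := by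
  simp only [tdet]; ring

theorem tdet_neg (τ : ℝ) (x y z : E3) : tdet (-τ) x y z = - tdet τ x y z := by
  simp only [tdet]; ring

theorem tdet_self (τ : ℝ) (x y : E3) : tdet τ x y x = 0 := by
  simp only [tdet]; ring

theorem tdet_self_right (τ : ℝ) (x y : E3) : tdet τ x y y = 0 := by
  simp only [tdet]; ring

theorem tdet_sub (τ : ℝ) (x y z w : E3) : tdet τ x y (z - w) = tdet τ x y z - tdet τ x y w := by
  simp [tdet]; ring

theorem tdet_smul (τ a : ℝ) (x y z : E3) : tdet τ x y (a • z) = a * tdet τ x y z := by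
  simp [tdet]; ring

/-- The dual cone of a finite set of vectors. -/
def dualCone (P : Finset E3) : Set E3 := {e | ∀ x ∈ P, 0 ≤ ⟪e, x⟫}

/-- A diametral pair `c`, `d` of the polar of the cone over `P`, with inner product `-C`, together
with the centers `p`, `q` of the two sides of the lune that it determines. -/
structure Chord (P : Finset E3) (C S : ℝ) where
  c : E3
  d : E3
  p : E3
  q : E3
  hc : c ∈ dualCone P
  hd : d ∈ dualCone P
  pp : ⟪p, p⟫ = 1
  qq : ⟪q, q⟫ = 1
  pq : ⟪p, q⟫ = C
  c_eq : S • c = q - C • p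
  d_eq : S • d = p - C • q
  hp : ∀ e ∈ dualCone P, 0 ≤ ⟪e, p⟫
  hq : ∀ e ∈ dualCone P, 0 ≤ ⟪e, q⟫

variable {P : Finset E3} {C S : ℝ}

/-- The chord with its ends interchanged. -/
def Chord.flip (a : Chord P C S) : Chord P C S :=
  ⟨a.d, a.c, a.q, a.p, a.hd, a.hc, a.qq, a.pp, by rw [real_inner_comm]; exact a.pq, a.d_eq, a.c_eq,
    a.hq, a.hp⟩

namespace Chord

variable (a b e : Chord P C S)

theorem qp : ⟪a.q, a.p⟫ = C := by rw [real_inner_comm]; exact a.pq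

theorem inner_c (x : E3) : S * ⟪a.c, x⟫ = ⟪a.q, x⟫ - C * ⟪a.p, x⟫ := by
  have := congrArg (fun v => ⟪v, x⟫) a.c_eq
  simpa [inner_smul_left, inner_sub_left] using this

theorem inner_d (x : E3) : S * ⟪a.d, x⟫ = ⟪a.p, x⟫ - C * ⟪a.q, x⟫ := a.flip.inner_c x

theorem tdet_c (τ : ℝ) (x y : E3) : S * tdet τ x y a.c = tdet τ x y a.q - C * tdet τ x y a.p := by
  have := congrArg (fun v => tdet τ x y v) a.c_eq
  simpa [tdet_smul, tdet_sub] using this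

theorem tdet_d (τ : ℝ) (x y : E3) : S * tdet τ x y a.d = tdet τ x y a.p - C * tdet τ x y a.q :=
  a.flip.tdet_c τ x y

variable (hS : 0 < S) (hCS : C ^ 2 + S ^ 2 = 1)
include hS

theorem cp : ⟪a.c, a.p⟫ = 0 := by
  have := a.inner_c a.p
  rw [a.qp, a.pp] at this
  have : S * ⟪a.c, a.p⟫ = 0 := by linarith
  exact (mul_eq_zero.1 this).resolve_left hS.ne'

theorem dq : ⟪a.d, a.q⟫ = 0 := a.flip.cp hS

include hCS

theorem cq : ⟪a.c, a.q⟫ = S := by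
  have := a.inner_c a.q
  rw [a.qq, a.pq] at this
  have : S * ⟪a.c, a.q⟫ = S * S := by nlinarith
  exact mul_left_cancel₀ hS.ne' this

theorem dp : ⟪a.d, a.p⟫ = S := a.flip.cq hS hCS

theorem cd : ⟪a.c, a.d⟫ = -C := by
  have h := a.inner_c a.d
  have h1 := a.dp hS hCS
  have h2 := a.dq hS
  rw [real_inner_comm] at h1 h2
  rw [h1, h2] at h
  have : S * ⟪a.c, a.d⟫ = S * (-C) := by linarith
  exact mul_left_cancel₀ hS.ne' this

theorem cc : ⟪a.c, a.c⟫ = 1 := by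
  have h := a.inner_c a.c
  have h1 := a.cq hS hCS
  have h2 := a.cp hS
  rw [real_inner_comm] at h1 h2
  rw [h1, h2] at h
  have : S * ⟪a.c, a.c⟫ = S * 1 := by linarith
  exact mul_left_cancel₀ hS.ne' this

theorem dd : ⟪a.d, a.d⟫ = 1 := a.flip.cc hS hCS

end Chord

end SphericalPolygon

/-! ### Crossing of chords and the second variation. -/

namespace SphericalPolygon

theorem cross_swap (x y : E3) : cross x y = - cross y x := by
  ext i; fin_cases i <;> simp [cross] <;> ring

/-- The vectors `d × y`, `d × z` and `q` all lie in the plane orthogonal to `d`, so they are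
dependent. This later orders contact points and apexes along one supporting circle. -/
theorem cross_identity (d y z q : E3) (h : ⟪d, q⟫ = 0) :
    ⟪z, q⟫ • cross d y = ⟪y, q⟫ • cross d z + tdet 1 d y z • q := by
  rw [inner_coord] at h
  ext i; fin_cases i <;> simp [cross, inner_coord, tdet]
  · linear_combination (-(y 1 * z 2 - y 2 * z 1)) * h
  · linear_combination (-(y 2 * z 0 - y 0 * z 2)) * h
  · linear_combination (-(y 0 * z 1 - y 1 * z 0)) * h

theorem parallel_cross (d e x : E3) (h1 : ⟪d, x⟫ = 0) (h2 : ⟪e, x⟫ = 0) :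
    ⟪cross d e, cross d e⟫ • x = ⟪cross d e, x⟫ • cross d e := by
  rw [inner_coord] at h1 h2
  rw [inner_coord (cross d e) (cross d e), inner_coord (cross d e) x]
  ext i; fin_cases i <;> simp [cross]
  · linear_combination
      (e 1 * (d 0 * e 1 - d 1 * e 0) - e 2 * (d 2 * e 0 - d 0 * e 2)) * h1
        + (d 2 * (d 2 * e 0 - d 0 * e 2) - d 1 * (d 0 * e 1 - d 1 * e 0)) * h2
  · linear_combination
      (e 2 * (d 1 * e 2 - d 2 * e 1) - e 0 * (d 0 * e 1 - d 1 * e 0)) * h1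
        + (d 0 * (d 0 * e 1 - d 1 * e 0) - d 2 * (d 1 * e 2 - d 2 * e 1)) * h2
  · linear_combination
      (e 0 * (d 2 * e 0 - d 0 * e 2) - e 1 * (d 1 * e 2 - d 2 * e 1)) * h1
        + (d 1 * (d 1 * e 2 - d 2 * e 1) - d 0 * (d 2 * e 0 - d 0 * e 2)) * h2

theorem tdet_cross {τ : ℝ} (hτ : τ ^ 2 = 1) (x y z w : E3) :
    tdet τ x y (τ • cross z w) = ⟪x, z⟫ * ⟪y, w⟫ - ⟪x, w⟫ * ⟪y, z⟫ := by
  rw [← inner_cross_cross, ← inner_cross, inner_smul_left, inner_smul_right]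
  simp only [conj_trivial]
  linear_combination ⟪cross x y, cross z w⟫ * hτ

theorem gram_identity {τ : ℝ} (hτ : τ ^ 2 = 1) (p q x e : E3) :
    tdet τ p q x * tdet τ p q e =
      ⟪p, p⟫ * (⟪q, q⟫ * ⟪x, e⟫ - ⟪q, e⟫ * ⟪q, x⟫)
        - ⟪p, q⟫ * (⟪p, q⟫ * ⟪x, e⟫ - ⟪q, e⟫ * ⟪p, x⟫)
        + ⟪p, e⟫ * (⟪p, q⟫ * ⟪q, x⟫ - ⟪q, q⟫ * ⟪p, x⟫) := by
  have : tdet τ p q x * tdet τ p q e = τ ^ 2 * (tdet 1 p q x * tdet 1 p q e) := by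
    simp only [tdet]; ring
  rw [this, hτ]
  simp only [inner_coord, tdet]; ring

theorem eq_of_inner_eq_one {x y : E3} (hx : ⟪x, x⟫ = 1) (hy : ⟪y, y⟫ = 1) (h : ⟪x, y⟫ = 1) :
    x = y := by
  have : ⟪x - y, x - y⟫ = 0 := by
    rw [inner_sub_left, inner_sub_right, inner_sub_right, real_inner_comm x y]; linarith
  exact sub_eq_zero.1 (inner_self_eq_zero.1 this)

variable {P : Finset E3} {C S τ : ℝ}

/-- The chord `b` is obtained from `a` by a rotation in the direction given by `τ`. -/
def Ord (τ : ℝ) (a b : Chord P C S) : Prop :=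
  tdet τ a.p a.q b.p ≤ 0 ∧ 0 ≤ tdet τ a.p a.q b.q ∧ 0 < tdet τ a.p a.q b.q - tdet τ a.p a.q b.p

theorem Ord.flip {a b : Chord P C S} (h : Ord τ a b) : Ord τ a.flip b.flip := by
  obtain ⟨h1, h2, h3⟩ := h
  simp only [Ord, Chord.flip, tdet_swap τ a.q a.p]
  exact ⟨by linarith, by linarith, by linarith⟩

theorem tdet_pair (τ : ℝ) (p q y z e : E3) :
    tdet τ y z p * ⟪e, q⟫ - tdet τ y z q * ⟪e, p⟫
      = tdet τ p q z * ⟪e, y⟫ - tdet τ p q y * ⟪e, z⟫ := by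
  have := plucker τ e q y z p
  rw [tdet_rot τ y z q, tdet_rot τ z q y, tdet_rot τ p q z, tdet_rot τ p q y]
  linarith

namespace Chord

variable (a b e : Chord P C S)

theorem tdet_top (hS : 0 < S) (hCS : C ^ 2 + S ^ 2 = 1) (τ : ℝ) (y z : E3) :
    S * tdet τ a.q y z = tdet τ a.p a.q y * ⟪a.d, z⟫ - tdet τ a.p a.q z * ⟪a.d, y⟫ := by
  have h := plucker τ a.d a.q y z a.p
  rw [a.dq hS, a.dp hS hCS] at h
  rw [tdet_rot τ a.p a.q y, tdet_rot τ a.p a.q z]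
  linarith

theorem tdet_bot (hS : 0 < S) (hCS : C ^ 2 + S ^ 2 = 1) (τ : ℝ) (y z : E3) :
    S * tdet τ a.p y z = tdet τ a.p a.q z * ⟪a.c, y⟫ - tdet τ a.p a.q y * ⟪a.c, z⟫ := by
  have h := a.flip.tdet_top hS hCS τ y z
  simp only [Chord.flip, tdet_swap τ a.q a.p] at h
  linarith

theorem tdet_bot_three (hS : 0 < S) (τ : ℝ) (y z u : E3) :
    tdet τ a.p y u * ⟪a.c, z⟫ = tdet τ a.p y z * ⟪a.c, u⟫ + tdet τ a.p z u * ⟪a.c, y⟫ := by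
  have h := plucker τ a.c a.p y z u
  rw [a.cp hS] at h
  linarith

/-- Within the plane of the chord, `d` and `c` are `S` times the basis dual to `p`, `q`, and `p × q`
is a normal of squared length `S ^ 2`. This is the resulting expansion of `x`, tested against `e`.
-/
theorem decomp (hτ : τ ^ 2 = 1) (hCS : C ^ 2 + S ^ 2 = 1) (x e : E3) :
    S ^ 2 * ⟪e, x⟫ = S * ⟪a.d, x⟫ * ⟪e, a.p⟫ + S * ⟪a.c, x⟫ * ⟪e, a.q⟫
      + tdet τ a.p a.q x * tdet τ a.p a.q e := by
  rw [gram_identity hτ, a.inner_c, a.inner_d, a.pp, a.qq, a.pq, real_inner_comm e x,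
    real_inner_comm e a.p, real_inner_comm e a.q]
  linear_combination ⟪e, x⟫ * hCS

/-- The pole `b.c` vanishes at `b.p` but is nonnegative at `a.p` and `a.q`, so the normal term in
`decomp` is nonpositive; likewise for `b.d` at `b.q`. Ends of `b` strictly on one side of the plane
of `a` would violate the product of the two inequalities, as `C < 1`. -/
theorem crossing (hC : C < 1) (hC0 : 0 < C) (hS : 0 < S) (hCS : C ^ 2 + S ^ 2 = 1)
    (hτ : τ ^ 2 = 1) : tdet τ a.p a.q b.p * tdet τ a.p a.q b.q ≤ 0 := by
  have h1 := a.decomp hτ hCS b.p b.c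
  have h2 := a.decomp hτ hCS b.q b.d
  rw [b.cp hS] at h1
  rw [b.dq hS] at h2
  have e1 := b.tdet_c τ a.p a.q
  have e2 := b.tdet_d τ a.p a.q
  have n1 := mul_nonneg (mul_nonneg hS.le (b.hp _ a.hd)) (a.hp _ b.hc)
  have n2 := mul_nonneg (mul_nonneg hS.le (b.hp _ a.hc)) (a.hq _ b.hc)
  have n3 := mul_nonneg (mul_nonneg hS.le (b.hq _ a.hd)) (a.hp _ b.hd)
  have n4 := mul_nonneg (mul_nonneg hS.le (b.hq _ a.hc)) (a.hq _ b.hd)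
  set x := tdet τ a.p a.q b.p
  set y := tdet τ a.p a.q b.q
  have k1 : x * (y - C * x) ≤ 0 := by rw [← e1]; nlinarith
  have k2 : y * (x - C * y) ≤ 0 := by rw [← e2]; nlinarith
  by_contra hcon
  push Not at hcon
  have k3 : x * y ≤ C * x ^ 2 := by linarith
  have k4 : x * y ≤ C * y ^ 2 := by linarith
  have k5 : (x * y) * (x * y) ≤ (C * x ^ 2) * (C * y ^ 2) :=
    mul_le_mul k3 k4 hcon.le (by positivity)
  have h6 : 0 < (x * y) ^ 2 := by positivity
  have h7 : (1 - C ^ 2) * (x * y) ^ 2 ≤ 0 := by nlinarith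
  have h8 : 0 < 1 - C ^ 2 := by nlinarith
  have := mul_pos h8 h6
  linarith

/-- The circle with pole `d` meets the plane of the chord only in `±q`, and the sign of `⟪c, x⟫`
excludes `-q`. -/
theorem collapse (hS : 0 < S) (hCS : C ^ 2 + S ^ 2 = 1) (hτ : τ ^ 2 = 1) {x : E3}
    (hx : ⟪x, x⟫ = 1) (h : tdet τ a.p a.q x = 0) (hd : ⟪a.d, x⟫ = 0) (hc : 0 ≤ ⟪a.c, x⟫) :
    a.q = x := by
  have h1 := a.decomp hτ hCS x x
  rw [hx, h, hd] at h1
  have h2 := a.inner_d x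
  have h3 := a.inner_c x
  rw [hd] at h2
  have h4 : ⟪a.q, x⟫ * ⟪a.c, x⟫ = S := by
    rw [real_inner_comm a.q x] at h1
    have : S * (⟪a.q, x⟫ * ⟪a.c, x⟫) = S * S := by linarith
    exact mul_left_cancel₀ hS.ne' this
  have h5 : ⟪a.c, x⟫ = S * ⟪a.q, x⟫ := by
    have : S * ⟪a.c, x⟫ = S * (S * ⟪a.q, x⟫) := by
      linear_combination h3 + C * h2 - ⟪a.q, x⟫ * hCS
    exact mul_left_cancel₀ hS.ne' this
  have h6 : ⟪a.q, x⟫ ^ 2 = 1 := by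
    rw [h5] at h4
    have : S * ⟪a.q, x⟫ ^ 2 = S * 1 := by linarith
    exact mul_left_cancel₀ hS.ne' this
  have h7 : 0 ≤ ⟪a.q, x⟫ := by
    rw [h5] at hc
    exact nonneg_of_mul_nonneg_right hc hS
  exact eq_of_inner_eq_one a.qq hx (by nlinarith)

/-- The second order condition at a diametral pair. -/
theorem second_variation (hC : C < 1) (hS : 0 < S) (hCS : C ^ 2 + S ^ 2 = 1)
    (hτ : τ ^ 2 = 1)
    (hF : ∀ u ∈ dualCone P, ∀ v ∈ dualCone P, ⟪u, u⟫ = ⟪v, v⟫ → -C * ⟪u, u⟫ ≤ ⟪u, v⟫)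
    {f g : E3} (hf : f ∈ dualCone P) (hg : g ∈ dualCone P) (hfp : ⟪f, a.p⟫ = 0)
    (hgq : ⟪g, a.q⟫ = 0) : 0 ≤ tdet τ a.p a.q f * tdet τ a.p a.q g := by
  by_contra hcon
  push Not at hcon
  have hfp' : ⟪a.p, f⟫ = 0 := by rw [real_inner_comm]; exact hfp
  have hgq' : ⟪a.q, g⟫ = 0 := by rw [real_inner_comm]; exact hgq
  -- With `n` the unit normal of the plane of the chord, `f = α c + β n` and `g = γ d + δ n`.
  obtain ⟨β, hβ⟩ : ∃ β, S * β = tdet τ a.p a.q f := ⟨_, mul_div_cancel₀ _ hS.ne'⟩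
  obtain ⟨δ, hδ⟩ : ∃ δ, S * δ = tdet τ a.p a.q g := ⟨_, mul_div_cancel₀ _ hS.ne'⟩
  have hcf := a.inner_c f
  have hdf := a.inner_d f
  have hcg := a.inner_c g
  have hdg := a.inner_d g
  rw [hfp'] at hcf hdf
  rw [hgq'] at hcg hdg
  set α := ⟪a.c, f⟫ with hα
  set γ := ⟪a.d, g⟫ with hγ
  have hdf' : ⟪a.d, f⟫ = -C * α := mul_left_cancel₀ hS.ne' (by linear_combination hdf + C * hcf)
  have hcg' : ⟪a.c, g⟫ = -C * γ :=
    mul_left_cancel₀ hS.ne' (by linear_combination hcg + C * hdg)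
  have hS2 : (S ^ 2) ≠ 0 := by positivity
  have hff : ⟪f, f⟫ = α ^ 2 + β ^ 2 := by
    have h := a.decomp hτ hCS f f
    rw [hfp, ← hβ, real_inner_comm a.q f] at h
    exact mul_left_cancel₀ hS2 (by linear_combination h - S * α * hcf)
  have hgg : ⟪g, g⟫ = γ ^ 2 + δ ^ 2 := by
    have h := a.decomp hτ hCS g g
    rw [hgq, ← hδ, real_inner_comm a.p g] at h
    exact mul_left_cancel₀ hS2 (by linear_combination h - S * γ * hdg)
  have hfg : ⟪f, g⟫ = -C * α * γ + β * δ := by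
    have h := a.decomp hτ hCS f g
    rw [hgq, ← hβ, ← hδ, real_inner_comm a.p g, hdf', real_inner_comm f g] at h
    exact mul_left_cancel₀ hS2 (by linear_combination h + S * C * α * hdg)
  have hneg : β * δ < 0 := by
    rw [← hβ, ← hδ] at hcon
    have : S ^ 2 * (β * δ) < 0 := by linarith
    exact (pos_iff_neg_of_mul_neg this).1 (by positivity)
  set R := |δ| * |α| + |β| * |γ| with hR
  have m1 : 0 ≤ R - |δ| * α := by
    have := mul_le_mul_of_nonneg_left (le_abs_self α) (abs_nonneg δ)
    have : 0 ≤ |β| * |γ| := by positivity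
    linarith
  have m2 : 0 ≤ R - |β| * γ := by
    have := mul_le_mul_of_nonneg_left (le_abs_self γ) (abs_nonneg β)
    have : 0 ≤ |δ| * |α| := by positivity
    linarith
  -- These are `R c + |δ| β n` and `R d + |β| δ n`: equally long, tilted to opposite sides. `R` is
  -- large enough to keep them conic combinations inside the dual cone, and `⟪u, v⟫` falls below `-C
  -- ⟪u, u⟫` by `(1 - C) β² δ²`.
  set u := (R - |δ| * α) • a.c + |δ| • f with hu
  set v := (R - |β| * γ) • a.d + |β| • g with hv
  have huK : u ∈ dualCone P := fun x hx => by
    rw [hu, inner_add_left, inner_smul_left, inner_smul_left]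
    exact add_nonneg (mul_nonneg m1 (a.hc x hx)) (mul_nonneg (abs_nonneg _) (hf x hx))
  have hvK : v ∈ dualCone P := fun x hx => by
    rw [hv, inner_add_left, inner_smul_left, inner_smul_left]
    exact add_nonneg (mul_nonneg m2 (a.hd x hx)) (mul_nonneg (abs_nonneg _) (hg x hx))
  have hb2 : |β| ^ 2 = β ^ 2 := sq_abs β
  have hd2 : |δ| ^ 2 = δ ^ 2 := sq_abs δ
  have huu : ⟪u, u⟫ = R ^ 2 + β ^ 2 * δ ^ 2 := by
    simp only [hu, inner_add_left, inner_add_right, inner_smul_left, inner_smul_right,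
      conj_trivial, real_inner_comm a.c f, a.cc hS hCS, hff, ← hα]
    linear_combination (β ^ 2) * hd2
  have hvv : ⟪v, v⟫ = R ^ 2 + β ^ 2 * δ ^ 2 := by
    simp only [hv, inner_add_left, inner_add_right, inner_smul_left, inner_smul_right,
      conj_trivial, real_inner_comm a.d g, a.dd hS hCS, hgg, ← hγ]
    linear_combination (δ ^ 2) * hb2
  have habs : |δ| * |β| = -(β * δ) := by rw [← abs_mul, mul_comm, abs_of_neg hneg]
  have huv : ⟪u, v⟫ = -C * R ^ 2 - β ^ 2 * δ ^ 2 := by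
    simp only [hu, hv, inner_add_left, inner_add_right, inner_smul_left, inner_smul_right,
      conj_trivial, real_inner_comm a.d f, a.cd hS hCS, hfg, hcg', hdf']
    linear_combination (β * δ) * habs
  have := hF u huK v hvK (by rw [huu, hvv])
  rw [huu, huv] at this
  have : 0 < β ^ 2 * δ ^ 2 := by rw [← mul_pow]; exact sq_pos_of_neg hneg
  nlinarith

end Chord

end SphericalPolygon

/-! ### The rotation order of chords. -/

namespace SphericalPolygon

open InnerProductGeometry

variable {P : Finset E3} {C S τ : ℝ} {a b e : Chord P C S}

theorem neg_sq_one (hτ : τ ^ 2 = 1) : (-τ) ^ 2 = 1 := by rw [neg_sq]; exact hτ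

theorem Chord.tdet_cd (a : Chord P C S) (hS : 0 < S) (hCS : C ^ 2 + S ^ 2 = 1) (τ : ℝ) (x : E3) :
    tdet τ a.c a.d x = - tdet τ a.p a.q x := by
  have h1 : tdet τ (S • a.c) (S • a.d) x = S ^ 2 * tdet τ a.c a.d x := by
    simp [tdet]; ring
  have h2 : tdet τ (a.q - C • a.p) (a.p - C • a.q) x = - ((1 - C ^ 2) * tdet τ a.p a.q x) := by
    simp [tdet]; ring
  rw [a.c_eq, a.d_eq, h2, ← hCS] at h1
  have hS2 : (S ^ 2) ≠ 0 := by positivity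
  exact mul_left_cancel₀ hS2 (by linarith)

section Order

variable (hS : 0 < S) (hCS : C ^ 2 + S ^ 2 = 1)
include hS hCS

/-- Testing `tdet_pair` at the poles of `a` expresses the determinants of `b` by those of `a` with
coefficients of known sign. If both ends of `a` lay in the plane of `b`, the same relation at the
poles of `b` would put `b` in the plane of `a`. -/
theorem Ord.symm (h : Ord τ a b) : Ord (-τ) b a := by
  obtain ⟨h1, h2, h3⟩ := h
  have r := fun x => tdet_pair τ a.p a.q b.p b.q x
  have r1 := r a.c
  have r2 := r a.d
  have r3 := r b.c
  have r4 := r b.d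
  rw [a.cp hS, a.cq hS hCS] at r1
  rw [a.dq hS, a.dp hS hCS] at r2
  rw [b.cp hS, b.cq hS hCS] at r3
  rw [b.dq hS, b.dp hS hCS] at r4
  have p1 : 0 ≤ tdet τ b.p b.q a.p := by
    have := mul_nonneg h2 (b.hp _ a.hc)
    have := mul_nonneg (neg_nonneg.2 h1) (b.hq _ a.hc)
    exact nonneg_of_mul_nonneg_left (by linarith : 0 ≤ tdet τ b.p b.q a.p * S) hS
  have p2 : tdet τ b.p b.q a.q ≤ 0 := by
    have := mul_nonneg h2 (b.hp _ a.hd)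
    have := mul_nonneg (neg_nonneg.2 h1) (b.hq _ a.hd)
    have := nonneg_of_mul_nonneg_left (by linarith : 0 ≤ (-tdet τ b.p b.q a.q) * S) hS
    linarith
  simp only [Ord, tdet_neg]
  refine ⟨by linarith, by linarith, ?_⟩
  by_contra hcon
  have e1 : tdet τ b.p b.q a.p = 0 := by linarith
  have e2 : tdet τ b.p b.q a.q = 0 := by linarith
  rw [e1, e2] at r3 r4
  have k1 : tdet τ a.p a.q b.p * S = 0 := by linarith
  have k2 : tdet τ a.p a.q b.q * S = 0 := by linarith
  have k1 := (mul_eq_zero.1 k1).resolve_right hS.ne'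
  have k2 := (mul_eq_zero.1 k2).resolve_right hS.ne'
  linarith

theorem Ord.rev (h : Ord (-τ) b a) : Ord τ a b := by
  have := h.symm hS hCS
  rwa [neg_neg] at this

theorem ord_or_ord (hC : C < 1) (hC0 : 0 < C) (hτ : τ ^ 2 = 1)
    (h : ¬ (tdet τ a.p a.q b.p = 0 ∧ tdet τ a.p a.q b.q = 0)) : Ord τ a b ∨ Ord τ b a := by
  have hx := a.crossing b hC hC0 hS hCS hτ
  by_cases h' : tdet τ a.p a.q b.p ≤ 0 ∧ 0 ≤ tdet τ a.p a.q b.q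
  · refine Or.inl ⟨h'.1, h'.2, ?_⟩
    by_contra hcon
    exact h ⟨by linarith, by linarith⟩
  · refine Or.inr (Ord.rev hS hCS ?_)
    have h1 : 0 ≤ tdet τ a.p a.q b.p := by
      by_contra hc
      push Not at hc
      exact h' ⟨hc.le, by nlinarith⟩
    have h2 : tdet τ a.p a.q b.q ≤ 0 := by
      by_contra hc
      push Not at hc
      exact h' ⟨by nlinarith, hc.le⟩
    simp only [Ord, tdet_neg]
    refine ⟨by linarith, by linarith, ?_⟩
    by_contra hcon
    exact h ⟨by linarith, by linarith⟩

/-- This determinant is the inner product of `a.c` with the apex `τ • cross a.d b.d`. Its positivity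
shows that the two supporting circles differ and selects one of their two intersection points. -/
theorem Ord.apex_pos (hC0 : 0 < C) (h : Ord τ a b) : 0 < tdet τ a.c a.d b.d := by
  obtain ⟨h1, h2, h3⟩ := h
  have e1 := b.tdet_d τ a.p a.q
  have e2 := a.tdet_cd hS hCS τ b.d
  have h4 : 0 ≤ C * tdet τ a.p a.q b.q := by positivity
  have h5 : 0 < S * tdet τ a.c a.d b.d := by
    rw [e2, mul_neg, e1]
    rcases h1.lt_or_eq with h | h
    · linarith
    · rw [h] at h3 ⊢
      have : 0 < C * tdet τ a.p a.q b.q := mul_pos hC0 (by linarith)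
      linarith
  exact pos_of_mul_pos_right h5 hS.le

/-- The tops `a.q` and `b.q` lie on different sides of the chord `e` and both on the inner side of
the circle supporting at `e.q`; so `e.q` cannot lie inside the circle through them. -/
theorem Ord.top_between (h1 : Ord τ a e) (h2 : Ord τ e b) : tdet τ a.q b.q e.q ≤ 0 := by
  obtain ⟨x1, x2, -⟩ := h1.symm hS hCS
  obtain ⟨y1, y2, -⟩ := h2
  rw [tdet_neg] at x1 x2
  have h := e.tdet_top hS hCS τ b.q a.q
  have n1 := mul_nonneg y2 (a.hq _ e.hd)
  have n2 := mul_nonneg x2 (b.hq _ e.hd)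
  have t1 := tdet_rot τ e.q b.q a.q
  have t2 := tdet_swap τ b.q a.q e.q
  have : 0 ≤ S * tdet τ e.q b.q a.q := by linarith
  have := nonneg_of_mul_nonneg_right this hS
  linarith

end Order

end SphericalPolygon

/-! ### Caps of vertices, and why ordered chords have different ends. -/

namespace SphericalPolygon

open InnerProductGeometry

variable {P : Finset E3} {C S τ : ℝ} {a b e : Chord P C S}

open Classical in
/-- The elements of `P` cut off by the plane through `x` and `y`. -/
noncomputable def capSet (P : Finset E3) (τ : ℝ) (x y : E3) : Finset E3 :=
  P.filter fun z => tdet τ x y z < 0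

theorem mem_capSet {x y z : E3} : z ∈ capSet P τ x y ↔ z ∈ P ∧ tdet τ x y z < 0 := by
  simp [capSet]

theorem capSet_neg (x y : E3) : capSet P (-τ) x y = capSet P τ y x := by
  ext z
  rw [mem_capSet, mem_capSet, tdet_neg, tdet_swap τ x y, neg_neg]

theorem cross_mem_dualCone {x y : E3} (h : capSet P τ x y = ∅) : τ • cross x y ∈ dualCone P := by
  intro z hz
  rw [inner_cross]
  by_contra hcon
  push Not at hcon
  have : z ∈ capSet P τ x y := mem_capSet.2 ⟨hz, hcon⟩
  rw [h] at this
  simp at this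

section

variable (hS : 0 < S) (hCS : C ^ 2 + S ^ 2 = 1)
include hS hCS

theorem Ord.insert_aux (h : Ord τ a b) {w : E3} (hw : 0 ≤ ⟪a.c, w⟫)
    (hcap : tdet τ a.p b.p w < 0) : tdet τ a.p a.q w < 0 ∧ 0 < ⟪a.c, b.p⟫ := by
  have h1 := a.tdet_bot hS hCS τ b.p w
  have h2 : tdet τ a.p a.q b.p * ⟪a.c, w⟫ ≤ 0 := mul_nonpos_of_nonpos_of_nonneg h.1 hw
  have h3 : S * tdet τ a.p b.p w < 0 := mul_neg_of_pos_of_neg hS hcap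
  have h4 : tdet τ a.p a.q w * ⟪a.c, b.p⟫ < 0 := by linarith
  have h5 := b.hp _ a.hc
  have h6 : tdet τ a.p a.q w < 0 := by
    by_contra hcon
    push Not at hcon
    have := mul_nonneg hcon h5
    linarith
  exact ⟨h6, by nlinarith⟩

theorem ord_of_neg (hC : C < 1) (hC0 : 0 < C) (hτ : τ ^ 2 = 1)
    (h : tdet τ a.p a.q e.p < 0) : Ord τ a e := by
  have hx := a.crossing e hC hC0 hS hCS hτ
  have : 0 ≤ tdet τ a.p a.q e.q := by
    by_contra hcon
    push Not at hcon
    have := mul_pos_of_neg_of_neg h hcon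
    linarith
  exact ⟨h.le, this, by linarith⟩

theorem Ord.insert (hC : C < 1) (hC0 : 0 < C) (hτ : τ ^ 2 = 1) (h : Ord τ a b)
    (he : e.p ∈ capSet P τ a.p b.p) : Ord τ a e ∧ Ord τ e b := by
  obtain ⟨heP, hcap⟩ := mem_capSet.1 he
  refine ⟨ord_of_neg hS hCS hC hC0 hτ (h.insert_aux hS hCS (a.hc _ heP) hcap).1, ?_⟩
  apply Ord.rev hS hCS
  have hcap' : tdet (-τ) b.p a.p e.p < 0 := by
    rw [tdet_neg, tdet_swap τ b.p a.p, neg_neg]; exact hcap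
  exact ord_of_neg hS hCS hC hC0 (neg_sq_one hτ)
    ((h.symm hS hCS).insert_aux hS hCS (b.hc _ heP) hcap').1

omit hCS in
-- Modulo `a.p` the vectors of `P` lie in a half-plane on which `a.c` is nonnegative, so their
-- angular order is transitive; `tdet_bot_three` expresses this.
theorem Chord.cap_subset (a : Chord P C S) {y z : E3} (hyz : tdet τ a.p y z ≤ 0)
    (hy : 0 < ⟪a.c, y⟫) (hz : 0 ≤ ⟪a.c, z⟫) : capSet P τ a.p z ⊆ capSet P τ a.p y := by
  intro x hx
  obtain ⟨hxP, hx⟩ := mem_capSet.1 hx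
  refine mem_capSet.2 ⟨hxP, ?_⟩
  have h := a.tdet_bot_three hS τ y z x
  have h1 := mul_nonneg (neg_nonneg.2 hyz) (a.hc x hxP)
  have h2 := mul_neg_of_neg_of_pos hx hy
  have h3 : tdet τ a.p y x * ⟪a.c, z⟫ < 0 := by linarith
  by_contra hcon
  push Not at hcon
  have := mul_nonneg hcon hz
  linarith

omit hS hCS in
theorem Ord.apex_ne (h : Ord τ a b) : ¬ (a.p = b.p ∧ a.q = b.q) := by
  rintro ⟨h1, h2⟩
  obtain ⟨-, -, h3⟩ := h
  rw [← h1, ← h2, tdet_self, tdet_self_right] at h3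
  linarith

/-- Induction on the number of vertices cut off between the bottoms. A chord inserted between two
chords with a common top must have that top too, which gives a smaller counterexample; the second
variation excludes the smallest one. -/
theorem Ord.tops_ne (hC : C < 1) (hC0 : 0 < C)
    (hF : ∀ u ∈ dualCone P, ∀ v ∈ dualCone P, ⟪u, u⟫ = ⟪v, v⟫ → -C * ⟪u, u⟫ ≤ ⟪u, v⟫)
    (hP : ∀ w ∈ P, ∃ x : Chord P C S, x.p = w) (hτ : τ ^ 2 = 1) :
    ∀ {a b : Chord P C S}, Ord τ a b → a.q ≠ b.q := by
  suffices H : ∀ n : ℕ, ∀ a b : Chord P C S, (capSet P τ a.p b.p).card = n → Ord τ a b →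
      a.q ≠ b.q from fun {a b} h => H _ a b rfl h
  intro n
  induction n using Nat.strong_induction_on with
  | _ n ih =>
  intro a b hn h hq
  rcases (capSet P τ a.p b.p).eq_empty_or_nonempty with hemp | ⟨w, hw⟩
  · have hf := cross_mem_dualCone hemp
    -- The plane through the bottoms and the circle of `b.d` at the common top support the cone with
    -- opposite tilts, the second one strict. Hence `⟪a.c, b.p⟫ = 0`, which makes the bottoms
    -- coincide.
    have hsv := a.second_variation hC hS hCS hτ hF hf b.hd
      (by rw [inner_cross, tdet_self]) (by rw [hq]; exact b.dq hS)
    rw [tdet_cross hτ, a.pp, a.qp, one_mul] at hsv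
    have h1 := b.tdet_d τ a.p a.q
    rw [← hq, tdet_self_right, mul_zero, sub_zero] at h1
    have h2 := h.2.2
    rw [← hq, tdet_self_right] at h2
    have h3 : tdet τ a.p a.q b.d < 0 := by
      have : S * tdet τ a.p a.q b.d < 0 := by linarith
      by_contra hcon
      push Not at hcon
      have := mul_nonneg hS.le hcon
      linarith
    have h4 := a.inner_c b.p
    have h5 := mul_nonneg hS.le (b.hp _ a.hc)
    have h6 : ⟪a.q, b.p⟫ = C := by rw [hq, real_inner_comm]; exact b.pq
    have h7 : ⟪a.p, b.p⟫ = 1 := by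
      have k : ⟪a.q, b.p⟫ - ⟪a.p, b.p⟫ * C = 0 := by nlinarith
      rw [h6] at k
      exact mul_left_cancel₀ hC0.ne' (by linarith)
    exact h.apex_ne ⟨eq_of_inner_eq_one a.pp b.pp h7, hq⟩
  · obtain ⟨hwP, hcap⟩ := mem_capSet.1 hw
    obtain ⟨e, rfl⟩ := hP w hwP
    obtain ⟨h1, h2⟩ := h.insert hS hCS hC hC0 hτ hw
    have hac := h.insert_aux hS hCS (a.hc _ hwP) hcap
    have g1 := (h1.symm hS hCS).2.1
    rw [tdet_neg] at g1
    have g2 := h2.2.1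
    rw [← hq] at g2
    have g3 : tdet τ e.p e.q a.q = 0 := by linarith
    have k1 := fun x => e.decomp hτ hCS a.q x
    simp only [g3, zero_mul, add_zero] at k1
    have k2 := k1 a.d
    have k3 := k1 b.d
    rw [a.dq hS] at k2
    rw [hq, b.dq hS, ← hq] at k3
    have n1 := a.hq _ e.hd
    have n2 := a.hq _ e.hc
    have n3 := e.hp _ a.hd
    have n4 := e.hq _ a.hd
    have n5 := e.hp _ b.hd
    have n6 := e.hq _ b.hd
    -- The common top lies on the arc from `e.p` to `e.q`. If it were interior, `a.d` and `b.d`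
    -- would vanish on the whole arc and be parallel, against `apex_pos`.
    have hqe : a.q = e.q := by
      rcases n1.eq_or_lt with z | z
      · exact (e.collapse hS hCS hτ a.qq g3 z.symm n2).symm
      rcases n2.eq_or_lt with y | y
      · exfalso
        have : tdet τ e.flip.p e.flip.q a.q = 0 := by
          simp only [Chord.flip, tdet_swap τ e.q e.p, g3, neg_zero]
        have := e.flip.collapse hS hCS hτ a.qq this y.symm n1
        simp only [Chord.flip] at this
        have := hac.1
        rw [‹e.p = a.q›, tdet_self_right] at this
        exact lt_irrefl _ this
      · exfalso
        have m1 := mul_nonneg (mul_nonneg hS.le n1) n3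
        have m2 := mul_nonneg (mul_nonneg hS.le n2) n4
        have m3 := mul_nonneg (mul_nonneg hS.le n1) n5
        have m4 := mul_nonneg (mul_nonneg hS.le n2) n6
        have z1 : ⟪a.d, e.p⟫ = 0 :=
          (mul_eq_zero.1 (by linarith : S * ⟪e.d, a.q⟫ * ⟪a.d, e.p⟫ = 0)).resolve_left (by positivity)
        have z2 : ⟪a.d, e.q⟫ = 0 :=
          (mul_eq_zero.1 (by linarith : S * ⟪e.c, a.q⟫ * ⟪a.d, e.q⟫ = 0)).resolve_left (by positivity)
        have z3 : ⟪b.d, e.p⟫ = 0 :=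
          (mul_eq_zero.1 (by linarith : S * ⟪e.d, a.q⟫ * ⟪b.d, e.p⟫ = 0)).resolve_left (by positivity)
        have z4 : ⟪b.d, e.q⟫ = 0 :=
          (mul_eq_zero.1 (by linarith : S * ⟪e.c, a.q⟫ * ⟪b.d, e.q⟫ = 0)).resolve_left (by positivity)
        have hdd := fun x => e.decomp hτ hCS x b.d
        simp only [z3, z4, mul_zero, zero_add] at hdd
        have hda := fun x => e.decomp hτ hCS x a.d
        simp only [z1, z2, mul_zero, zero_add] at hda
        have hpos := h.apex_pos hS hCS hC0
        rw [← inner_cross, real_inner_comm] at hpos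
        have d1 := hdd (τ • cross a.c a.d)
        have d2 := hda (τ • cross a.c a.d)
        rw [real_inner_comm, inner_cross, tdet_self_right] at d2
        rcases mul_eq_zero.1 (by linarith : tdet τ e.p e.q (τ • cross a.c a.d) * tdet τ e.p e.q a.d = 0)
          with r | r
        · rw [r] at d1
          have : 0 < S ^ 2 * ⟪b.d, τ • cross a.c a.d⟫ := by positivity
          linarith
        · have := hda a.p
          rw [r, a.dp hS hCS] at this
          have : 0 < S ^ 2 * S := by positivity
          linarith
    refine ih _ ?_ a e rfl h1 hqe
    rw [← hn]
    refine Finset.card_lt_card ⟨a.cap_subset hS hcap.le hac.2 (a.hc _ hwP), fun hsub => ?_⟩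
    have := mem_capSet.1 (hsub hw)
    rw [tdet_self_right] at this
    exact lt_irrefl _ this.2

end

end SphericalPolygon

/-! ### Neighbouring chords, and the comparison of nested paths. -/

namespace SphericalPolygon

open InnerProductGeometry

variable {P : Finset E3} {C S τ : ℝ} {a b e : Chord P C S}

section

variable (hS : 0 < S) (hCS : C ^ 2 + S ^ 2 = 1)
include hS hCS

/-- Otherwise `a.c` and `b.c` would both be normal to the plane of the two bottoms, hence parallel,
against `apex_pos` for the flipped chords. -/
theorem Ord.not_both_bot (hC0 : 0 < C) (hτ : τ ^ 2 = 1) (h : Ord τ a b) (hne : a.p ≠ b.p)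
    (h1 : ⟪a.c, b.p⟫ = 0) (h2 : ⟪b.c, a.p⟫ = 0) : False := by
  have k : ∀ z, tdet τ a.p a.q b.p * ⟪a.c, z⟫ = - (tdet τ b.p b.q a.p * ⟪b.c, z⟫) := fun z => by
    have e1 := a.tdet_bot hS hCS τ b.p z
    have e2 := b.tdet_bot hS hCS τ a.p z
    rw [h1] at e1
    rw [h2, tdet_swap τ b.p a.p] at e2
    linarith
  have hpos := h.flip.apex_pos hS hCS hC0
  simp only [Chord.flip] at hpos
  have k1 := k (τ • cross a.d a.c)
  rw [real_inner_comm, inner_cross, tdet_self_right, real_inner_comm, inner_cross] at k1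
  have d2 : tdet τ b.p b.q a.p = 0 :=
    (mul_eq_zero.1 (by linarith : tdet τ b.p b.q a.p * tdet τ a.d a.c b.c = 0)).resolve_right hpos.ne'
  have k2 := k a.q
  rw [d2, a.cq hS hCS] at k2
  have d1 : tdet τ a.p a.q b.p = 0 :=
    (mul_eq_zero.1 (by linarith : tdet τ a.p a.q b.p * S = 0)).resolve_right hS.ne'
  refine hne (a.flip.collapse hS hCS hτ b.pp ?_ h1 (b.hp _ a.hd))
  simp only [Chord.flip, tdet_swap τ a.q a.p, d1, neg_zero]

/-- Both planes support the cone, and their tilts against the chord `a` are `S ⟪a.c, b.p⟫` and `-S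
⟪a.d, b.q⟫`. These have opposite signs, which the second variation allows only if one vanishes. -/
theorem Ord.right_angle (hC : C < 1) (hτ : τ ^ 2 = 1)
    (hF : ∀ u ∈ dualCone P, ∀ v ∈ dualCone P, ⟪u, u⟫ = ⟪v, v⟫ → -C * ⟪u, u⟫ ≤ ⟪u, v⟫)
    (hbot : capSet P τ a.p b.p = ∅) (htop : capSet P τ a.q b.q = ∅) :
    ⟪a.c, b.p⟫ = 0 ∨ ⟪a.d, b.q⟫ = 0 := by
  have hsv := a.second_variation hC hS hCS hτ hF (cross_mem_dualCone hbot)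
    (cross_mem_dualCone htop) (by rw [inner_cross, tdet_self]) (by rw [inner_cross, tdet_self])
  rw [tdet_cross hτ, tdet_cross hτ, a.pp, a.qq, a.qp, a.pq] at hsv
  have h1 := a.inner_c b.p
  have h2 := a.inner_d b.q
  have n1 := b.hp _ a.hc
  have n2 := b.hq _ a.hd
  have h3 : 0 ≤ (S * ⟪a.c, b.p⟫) * (-(S * ⟪a.d, b.q⟫)) := by
    rw [h1, h2]; linarith
  have h4 : 0 ≤ S ^ 2 * (-(⟪a.c, b.p⟫ * ⟪a.d, b.q⟫)) := by linarith
  have h5 := nonneg_of_mul_nonneg_right h4 (by positivity)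
  have h6 := mul_nonneg n1 n2
  exact mul_eq_zero.1 (by linarith)

/-- There is a right angle at an end of `a` and at an end of `b`. `not_both_bot` excludes both at
the bottom or both at the top; in the mixed cases the two inner products, times `C`, equal the same
diagonal product `⟪a.q, b.p⟫` or `⟪a.p, b.q⟫`. -/
theorem Ord.base (hC : C < 1) (hC0 : 0 < C) (hτ : τ ^ 2 = 1)
    (hF : ∀ u ∈ dualCone P, ∀ v ∈ dualCone P, ⟪u, u⟫ = ⟪v, v⟫ → -C * ⟪u, u⟫ ≤ ⟪u, v⟫)
    (h : Ord τ a b) (hp : a.p ≠ b.p) (hq : a.q ≠ b.q)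
    (hbot : capSet P τ a.p b.p = ∅) (htop : capSet P τ a.q b.q = ∅) :
    ⟪a.p, b.p⟫ = ⟪a.q, b.q⟫ := by
  have ra := Ord.right_angle hS hCS hC hτ hF hbot htop
  have rb := Ord.right_angle (a := b) (b := a) hS hCS hC (neg_sq_one hτ) hF
    (by rw [capSet_neg]; exact hbot) (by rw [capSet_neg]; exact htop)
  rcases ra with x | x <;> rcases rb with y | y
  · exact (h.not_both_bot hS hCS hC0 hτ hp x y).elim
  · have h1 := a.inner_c b.p
    have h2 := b.inner_d a.q
    rw [x, mul_zero] at h1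
    rw [y, mul_zero, real_inner_comm a.q b.p, real_inner_comm a.q b.q] at h2
    exact mul_left_cancel₀ hC0.ne' (by linarith)
  · have h1 := a.inner_d b.q
    have h2 := b.inner_c a.p
    rw [x, mul_zero] at h1
    rw [y, mul_zero, real_inner_comm a.p b.p, real_inner_comm a.p b.q] at h2
    exact mul_left_cancel₀ hC0.ne' (by linarith)
  · exact (h.flip.not_both_bot hS hCS hC0 hτ hq x y).elim

theorem Chord.proportional (b : Chord P C S) {x : E3} (hx : ⟪b.d, x⟫ = 0)
    (hne : tdet τ b.p b.q x ≠ 0) {n : E3} (h1 : ⟪n, x⟫ = 0) (h2 : ⟪n, b.q⟫ = 0) (z : E3) :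
    S * ⟪n, z⟫ = ⟪b.d, z⟫ * ⟪n, b.p⟫ := by
  have e1 := plucker τ b.d b.q x z b.p
  have e2 := plucker τ n b.q x z b.p
  rw [b.dq hS, hx, b.dp hS hCS] at e1
  rw [h1, h2] at e2
  have r := tdet_rot τ b.p b.q x
  have : tdet τ b.q x b.p * (S * ⟪n, z⟫ - ⟪b.d, z⟫ * ⟪n, b.p⟫) = 0 := by
    linear_combination S * e2 - ⟪n, b.p⟫ * e1
  rw [← r] at this
  have := (mul_eq_zero.1 this).resolve_left hne
  linarith

/-- If `a.q` were on the circle supporting at `b.q`, so would be `e.q` between them. Then two tops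
coincide, or the plane of `e` or its supporting circle is that very circle; a sign at `a.p` and
`apex_pos` exclude the last two. -/
theorem Ord.inner_pos (hC0 : 0 < C) (hτ : τ ^ 2 = 1) (h : Ord τ a b) (h1 : Ord τ a e)
    (h2 : Ord τ e b) (hab : a.q ≠ b.q) (hae : a.q ≠ e.q) (heb : e.q ≠ b.q) :
    0 < ⟪b.d, a.q⟫ := by
  rcases (a.hq _ b.hd).eq_or_lt with hz | hz
  swap
  · exact hz
  exfalso
  have hz := hz.symm
  have hs := (h.symm hS hCS)
  have s2 := hs.2.1
  rw [tdet_neg] at s2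
  have hne : tdet τ b.p b.q a.q ≠ 0 := fun h0 =>
    hab (b.collapse hS hCS hτ a.qq h0 hz (a.hq _ b.hc)).symm
  have hbt := h1.top_between hS hCS h2
  have he : ⟪b.d, e.q⟫ = 0 := by
    have e1 := plucker τ b.d a.q b.q e.q b.p
    rw [hz, b.dq hS, b.dp hS hCS] at e1
    have r1 := tdet_rot τ b.p b.q a.q
    have r2 := tdet_swap τ a.q b.q b.p
    have n1 := mul_nonneg s2 (e.hq _ b.hd)
    have n2 := mul_nonneg (neg_nonneg.2 hbt) hS.le
    have : tdet τ b.p b.q a.q * ⟪b.d, e.q⟫ = 0 := by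
      rw [r2] at e1
      rw [r1] at n1 ⊢
      linarith
    exact (mul_eq_zero.1 this).resolve_left hne
  have e2 := e.tdet_top hS hCS τ b.q a.q
  have e3 := b.tdet_top hS hCS τ e.q a.q
  rw [hz, he, mul_zero, mul_zero, sub_zero] at e3
  have e3 := (mul_eq_zero.1 e3).resolve_left hS.ne'
  rw [tdet_swap, e3, neg_zero, mul_zero] at e2
  have o1 := h1.symm hS hCS
  simp only [Ord, tdet_neg] at o1
  have n1 := mul_nonneg h2.2.1 (a.hq _ e.hd)
  have n2 := mul_nonneg o1.2.1 (b.hq _ e.hd)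
  have z1 : tdet τ e.p e.q b.q * ⟪e.d, a.q⟫ = 0 := by linarith
  have z2 : tdet τ e.p e.q a.q * ⟪e.d, b.q⟫ = 0 := by linarith
  rcases mul_eq_zero.1 z1 with y1 | y1
  · rcases mul_eq_zero.1 z2 with y2 | y2
    · have k := b.proportional hS hCS hz hne (n := τ • cross e.p e.q)
        (by rw [inner_cross]; exact y2) (by rw [inner_cross]; exact y1) a.p
      rw [inner_cross, inner_cross] at k
      have p1 : 0 < tdet τ e.p e.q a.p := by linarith [o1.2.2]
      have p2 := mul_nonneg (a.hp _ b.hd) (neg_nonneg.2 h2.1)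
      have := mul_pos hS p1
      linarith
    · exact heb (e.collapse hS hCS hτ b.qq y1 y2 (b.hq _ e.hc))
  · rcases mul_eq_zero.1 z2 with y2 | y2
    · exact hae (e.collapse hS hCS hτ a.qq y2 y1 (a.hq _ e.hc)).symm
    · have k := b.proportional hS hCS hz hne (n := e.d) y1 y2
      have hpos := h2.apex_pos hS hCS hC0
      have k1 := k (τ • cross e.c e.d)
      rw [real_inner_comm, inner_cross, tdet_self_right, real_inner_comm, inner_cross] at k1
      have k2 : ⟪e.d, b.p⟫ = 0 :=
        (mul_eq_zero.1 (by linarith : tdet τ e.c e.d b.d * ⟪e.d, b.p⟫ = 0)).resolve_left hpos.ne'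
      have k3 := k e.p
      rw [k2, e.dp hS hCS] at k3
      have := mul_pos hS hS
      linarith

end

theorem angle_add_of_combination {x y z : E3} {r s t : ℝ} (hr : 0 < r) (hs : 0 ≤ s) (ht : 0 ≤ t)
    (hy : y ≠ 0) (h : r • y = s • x + t • z) : angle x z = angle x y + angle y z := by
  refine angle_eq_angle_add_add_angle_add_of_mem_span hy ?_
  rw [Submodule.mem_span_pair]
  refine ⟨(s / r).toNNReal, (t / r).toNNReal, ?_⟩
  rw [NNReal.smul_def, NNReal.smul_def, Real.coe_toNNReal _ (by positivity),
    Real.coe_toNNReal _ (by positivity)]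
  have : y = r⁻¹ • (s • x + t • z) := by rw [← h, smul_smul, inv_mul_cancel₀ hr.ne', one_smul]
  rw [this, smul_add, smul_smul, smul_smul, div_eq_inv_mul, div_eq_inv_mul]

section

variable (hS : 0 < S) (hCS : C ^ 2 + S ^ 2 = 1)
include hS hCS

/-- The apex `A1` of `a`, `e` lies on the arc from `a.q` to `A`, the apex `A2` of `e`, `b` on the
arc from `A` to `b.q`, and `e.q` between `A1` and `A2`. So the two inner paths join to the outer one
with its corner at `A` cut off. -/
theorem Ord.step (hC0 : 0 < C) (hτ : τ ^ 2 = 1) (h : Ord τ a b) (h1 : Ord τ a e)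
    (h2 : Ord τ e b) (hab : a.q ≠ b.q) (hae : a.q ≠ e.q) (heb : e.q ≠ b.q)
    (i1 : angle a.p e.p ≤ angle a.q (τ • cross a.d e.d) + angle (τ • cross a.d e.d) e.q)
    (i2 : angle e.p b.p ≤ angle e.q (τ • cross e.d b.d) + angle (τ • cross e.d b.d) b.q) :
    angle a.p b.p ≤ angle a.q (τ • cross a.d b.d) + angle (τ • cross a.d b.d) b.q := by
  have q1 := h.inner_pos hS hCS hC0 hτ h1 h2 hab hae heb
  have q2 : 0 < ⟪a.d, b.q⟫ := (h.symm hS hCS).inner_pos hS hCS hC0 (neg_sq_one hτ)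
    (h2.symm hS hCS) (h1.symm hS hCS) hab.symm heb.symm hae.symm
  have a0 := h.apex_pos hS hCS hC0
  have a1 := h1.apex_pos hS hCS hC0
  have a2 := h2.apex_pos hS hCS hC0
  set T := tdet τ a.d e.d b.d with hT
  have hT0 : 0 ≤ T := by
    have e1 := plucker τ e.q e.d b.d a.d e.q
    rw [real_inner_comm, e.dq hS, e.qq] at e1
    have o1 := h1.symm hS hCS
    simp only [Ord, tdet_neg] at o1
    have s1 := a.tdet_d τ e.p e.q
    have s2 := b.tdet_d τ e.p e.q
    have t1 := fun x => e.tdet_top hS hCS τ e.d x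
    have m : ∀ x, tdet τ e.p e.q x = S * tdet τ e.d e.q x := fun x => by
      have : S * tdet τ e.d e.q x = tdet τ (S • e.d) e.q x := by simp [tdet]; ring
      rw [this, e.d_eq]
      simp only [tdet, PiLp.sub_apply, PiLp.smul_apply, smul_eq_mul]; ring
    rw [m] at s1 s2
    rw [m a.p, m a.q] at o1 s1
    rw [m b.p, m b.q] at s2
    have h2' := h2
    simp only [Ord, m b.p, m b.q] at h2'
    have n1 : 0 ≤ S * (S * tdet τ e.d e.q a.d) := by
      rw [s1]; have := mul_nonneg hC0.le o1.2.1; linarith [o1.1]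
    have n2 : 0 ≤ S * (S * -tdet τ e.d e.q b.d) := by
      have := mul_nonneg hC0.le h2'.2.1; linarith [h2'.1]
    have n1 := nonneg_of_mul_nonneg_right (nonneg_of_mul_nonneg_right n1 hS) hS
    have n2 := nonneg_of_mul_nonneg_right (nonneg_of_mul_nonneg_right n2 hS) hS
    have m1 := mul_nonneg (e.hq _ b.hd) n1
    have m2 := mul_nonneg (e.hq _ a.hd) n2
    have r1 := tdet_rot τ a.d e.d b.d
    have r2 := tdet_rot τ e.q e.d a.d
    have r3 := tdet_swap τ e.q e.d a.d
    have r4 := tdet_rot τ e.q e.d b.d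
    have r5 := tdet_swap τ e.q e.d b.d
    rw [real_inner_comm b.d e.q, real_inner_comm a.d e.q, ← r2, r3, ← r4, r5] at e1
    rw [hT]
    linarith
  have hT1 : T = τ * tdet 1 a.d e.d b.d := by rw [hT]; simp only [tdet]; ring
  have I1 : ⟪b.d, a.q⟫ • (τ • cross a.d e.d) = T • a.q + ⟪e.d, a.q⟫ • (τ • cross a.d b.d) := by
    have := cross_identity a.d e.d b.d a.q (a.dq hS)
    rw [hT1]
    linear_combination (norm := module) τ • this
  have I2 : ⟪a.d, b.q⟫ • (τ • cross e.d b.d) = ⟪e.d, b.q⟫ • (τ • cross a.d b.d) + T • b.q := by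
    have := cross_identity b.d e.d a.d b.q (b.dq hS)
    have t : tdet 1 b.d e.d a.d = - tdet 1 a.d e.d b.d := by simp only [tdet]; ring
    rw [cross_swap b.d e.d, cross_swap b.d a.d, t] at this
    rw [hT1]
    linear_combination (norm := module) (-τ) • this
  have I3 : T • e.q = ⟪b.d, e.q⟫ • (τ • cross a.d e.d) + ⟪a.d, e.q⟫ • (τ • cross e.d b.d) := by
    have := cross_identity e.d a.d b.d e.q (e.dq hS)
    have t : tdet 1 e.d a.d b.d = - tdet 1 a.d e.d b.d := by simp only [tdet]; ring
    rw [cross_swap e.d a.d, t] at this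
    rw [hT1]
    linear_combination (norm := module) τ • this
  have pc1 : ⟪τ • cross a.d b.d, a.c⟫ = tdet τ a.c a.d b.d := by
    rw [inner_cross, ← tdet_rot]
  have pc2 : ⟪τ • cross a.d e.d, a.c⟫ = tdet τ a.c a.d e.d := by
    rw [inner_cross, ← tdet_rot]
  have pc3 : ⟪τ • cross e.d b.d, e.c⟫ = tdet τ e.c e.d b.d := by
    rw [inner_cross, ← tdet_rot]
  set A := τ • cross a.d b.d with hA
  set A1 := τ • cross a.d e.d with hA1
  set A2 := τ • cross e.d b.d with hA2
  have ne1 : A1 ≠ 0 := fun h0 => by rw [h0, inner_zero_left] at pc2; linarith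
  have ne2 : A2 ≠ 0 := fun h0 => by rw [h0, inner_zero_left] at pc3; linarith
  have s1 := angle_add_of_combination q1 hT0 (a.hq _ e.hd) ne1 I1
  have s2 := angle_add_of_combination q2 (b.hq _ e.hd) hT0 ne2 I2
  have tri := angle_le_angle_add_angle a.p e.p b.p
  -- If `T = 0`, the three supporting circles pass through one point: all three apexes and `e.q`
  -- have the same direction.
  rcases hT0.eq_or_lt with t0 | t0
  · rw [← t0, zero_smul] at I1 I2 I3
    rw [zero_add] at I1
    rw [add_zero] at I2
    have u1 : 0 < ⟪e.d, a.q⟫ := (a.hq _ e.hd).lt_of_ne fun h0 => by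
      rw [← h0, zero_smul] at I1
      exact (smul_ne_zero q1.ne' ne1) I1
    have u2 : 0 < ⟪e.d, b.q⟫ := (b.hq _ e.hd).lt_of_ne fun h0 => by
      rw [← h0, zero_smul] at I2
      exact (smul_ne_zero q2.ne' ne2) I2
    have pA : 0 < ⟪A, a.c⟫ := by rw [pc1]; exact a0
    have pA1 : 0 < ⟪A1, a.c⟫ := by rw [pc2]; exact a1
    have pA2 : 0 < ⟪A2, a.c⟫ := by
      have := congrArg (fun v => ⟪v, a.c⟫) I2
      simp only [inner_smul_left, conj_trivial] at this
      have := mul_pos u2 pA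
      exact pos_of_mul_pos_right (by linarith : 0 < ⟪a.d, b.q⟫ * ⟪A2, a.c⟫) q2.le
    have z := congrArg (fun v => ⟪v, a.c⟫) I3
    simp only [inner_smul_left, conj_trivial, inner_add_left, inner_zero_left] at z
    have n1 := mul_nonneg (e.hq _ b.hd) pA1.le
    have n2 := mul_nonneg (e.hq _ a.hd) pA2.le
    have z1 : ⟪b.d, e.q⟫ = 0 :=
      (mul_eq_zero.1 (by linarith : ⟪b.d, e.q⟫ * ⟪A1, a.c⟫ = 0)).resolve_right pA1.ne'
    have z2 : ⟪a.d, e.q⟫ = 0 :=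
      (mul_eq_zero.1 (by linarith : ⟪a.d, e.q⟫ * ⟪A2, a.c⟫ = 0)).resolve_right pA2.ne'
    have par : ⟪A, A⟫ • e.q = ⟪A, e.q⟫ • A := by
      have := parallel_cross a.d b.d e.q z2 z1
      simp only [hA, inner_smul_left, inner_smul_right, conj_trivial]
      linear_combination (norm := module) (τ * τ) • this
    have neA : A ≠ 0 := fun h0 => by rw [h0, inner_zero_left] at pA; exact lt_irrefl _ pA
    have pAA : 0 < ⟪A, A⟫ := real_inner_self_pos.2 neA
    have z3 := congrArg (fun v => ⟪v, a.c⟫) par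
    simp only [inner_smul_left, conj_trivial] at z3
    have n3 := mul_nonneg pAA.le (e.hq _ a.hc)
    rw [real_inner_comm e.q a.c, z3] at n3
    have n4 := nonneg_of_mul_nonneg_left n3 pA
    have ne3 : e.q ≠ 0 := fun h0 => by have := e.qq; rw [h0, inner_zero_left] at this; linarith
    have n5 : 0 < ⟪A, e.q⟫ := n4.lt_of_ne fun h0 => by
      rw [← h0, zero_smul] at par
      exact (smul_ne_zero pAA.ne' ne3) par
    have w0 : angle A e.q = 0 := by
      rw [← angle_smul_right_of_pos A e.q pAA, par, angle_smul_right_of_pos A A n5,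
        angle_self neA]
    have w1 : angle A1 e.q = 0 := by
      rw [← angle_smul_left_of_pos A1 e.q q1, I1, angle_smul_left_of_pos A e.q u1, w0]
    have w2 : angle e.q A2 = 0 := by
      rw [angle_comm, ← angle_smul_left_of_pos A2 e.q q2, I2, angle_smul_left_of_pos A e.q u2, w0]
    have := angle_nonneg A1 A
    have := angle_nonneg A A2
    linarith
  · have ne3 : e.q ≠ 0 := fun h0 => by have := e.qq; rw [h0, inner_zero_left] at this; linarith
    have s3 := angle_add_of_combination t0 (e.hq _ b.hd) (e.hq _ a.hd) ne3 I3
    have := angle_le_angle_add_angle A1 A A2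
    linarith

end

end SphericalPolygon

/-! ### Induction over the vertices between two chords. -/

namespace SphericalPolygon

open InnerProductGeometry

variable {P : Finset E3} {C S τ : ℝ} {a b e : Chord P C S}

theorem norm_eq_one {x : E3} (hx : ⟪x, x⟫ = 1) : ‖x‖ = 1 := by
  rw [real_inner_self_eq_norm_sq] at hx
  exact (pow_eq_one_iff_of_nonneg (norm_nonneg x) two_ne_zero).1 hx

section

variable (hS : 0 < S) (hCS : C ^ 2 + S ^ 2 = 1) (hC : C < 1) (hC0 : 0 < C)
  (hF : ∀ u ∈ dualCone P, ∀ v ∈ dualCone P, ⟪u, u⟫ = ⟪v, v⟫ → -C * ⟪u, u⟫ ≤ ⟪u, v⟫)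
  (hP : ∀ w ∈ P, ∃ x : Chord P C S, x.p = w)
include hS hCS hC hC0 hF hP

theorem Ord.bottoms_ne (hτ : τ ^ 2 = 1) (h : Ord τ a b) : a.p ≠ b.p :=
  Ord.tops_ne hS hCS hC hC0 hF hP hτ h.flip

/-- The bottom cap loses `e.p` itself. The top cap does not grow, by `cap_subset`, whose strict
hypothesis is supplied by `inner_pos`. -/
theorem Ord.card_lt (hτ : τ ^ 2 = 1) (h : Ord τ a b) (h1 : Ord τ a e) (h2 : Ord τ e b)
    (he : e.p ∈ capSet P τ a.p b.p) :
    (capSet P τ a.p e.p).card + (capSet P τ a.q e.q).card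
      < (capSet P τ a.p b.p).card + (capSet P τ a.q b.q).card := by
  have t := fun {x y : Chord P C S} (h : Ord τ x y) => Ord.tops_ne hS hCS hC hC0 hF hP hτ h
  have he' := (mem_capSet.1 he).2
  have hpos := (h.insert_aux hS hCS (e.hp _ a.hc) he').2
  refine add_lt_add_of_lt_of_le (Finset.card_lt_card ?_) (Finset.card_le_card ?_)
  · refine (Finset.ssubset_iff_of_subset (a.cap_subset hS he'.le hpos (e.hp _ a.hc))).2
      ⟨e.p, he, fun h => ?_⟩
    have := (mem_capSet.1 h).2
    rw [tdet_self_right] at this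
    exact lt_irrefl _ this
  · have q : 0 < ⟪a.d, b.q⟫ := (h.symm hS hCS).inner_pos hS hCS hC0 (neg_sq_one hτ)
      (h2.symm hS hCS) (h1.symm hS hCS) (t h).symm (t h2).symm (t h1).symm
    exact a.flip.cap_subset hS (h1.top_between hS hCS h2) q (e.hq _ a.hd)

theorem Ord.card_lt_right (hτ : τ ^ 2 = 1) (h : Ord τ a b) (h1 : Ord τ a e) (h2 : Ord τ e b)
    (he : e.p ∈ capSet P τ a.p b.p) :
    (capSet P τ e.p b.p).card + (capSet P τ e.q b.q).card
      < (capSet P τ a.p b.p).card + (capSet P τ a.q b.q).card := by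
  have := Ord.card_lt (τ := -τ) (a := b) (b := a) (e := e) hS hCS hC hC0 hF hP (neg_sq_one hτ)
    (h.symm hS hCS) (h2.symm hS hCS) (h1.symm hS hCS) (by rw [capSet_neg]; exact he)
  simpa only [capSet_neg] using this

theorem Ord.angle_le (hτ : τ ^ 2 = 1) : ∀ {a b : Chord P C S}, Ord τ a b →
    angle a.p b.p ≤ angle a.q (τ • cross a.d b.d) + angle (τ • cross a.d b.d) b.q := by
  suffices H : ∀ n : ℕ, ∀ a b : Chord P C S,
      (capSet P τ a.p b.p).card + (capSet P τ a.q b.q).card = n → Ord τ a b →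
      angle a.p b.p ≤ angle a.q (τ • cross a.d b.d) + angle (τ • cross a.d b.d) b.q from
    fun {a b} h => H _ a b rfl h
  have t := fun {x y : Chord P C S} (h : Ord τ x y) => Ord.tops_ne hS hCS hC hC0 hF hP hτ h
  intro n
  induction n using Nat.strong_induction_on with
  | _ n ih =>
    intro a b hn h
    subst hn
    rcases (capSet P τ a.p b.p).eq_empty_or_nonempty with hb | ⟨w, hw⟩
    · rcases (capSet P τ a.q b.q).eq_empty_or_nonempty with ht | ⟨w, hw⟩
      · have hbase := h.base hS hCS hC hC0 hτ hF (h.bottoms_ne hS hCS hC hC0 hF hP hτ) (t h) hb ht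
        have : angle a.p b.p = angle a.q b.q := by
          simp only [angle, norm_eq_one a.pp, norm_eq_one b.pp, norm_eq_one a.qq,
            norm_eq_one b.qq, hbase]
        rw [this]
        exact angle_le_angle_add_angle _ _ _
      -- A vertex in the top cap is the bottom of its own chord, so that chord is inserted upside
      -- down.
      · obtain ⟨e, rfl⟩ := hP w (mem_capSet.1 hw).1
        have hi := h.flip.insert hS hCS hC hC0 hτ (e := e) hw
        have h1 : Ord τ a e.flip := hi.1.flip
        have h2 : Ord τ e.flip b := hi.2.flip
        have l1 := h.flip.card_lt hS hCS hC hC0 hF hP hτ hi.1 hi.2 hw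
        have l2 := h.flip.card_lt_right hS hCS hC hC0 hF hP hτ hi.1 hi.2 hw
        simp only [Chord.flip] at l1 l2
        refine h.step hS hCS hC0 hτ h1 h2 (t h) (t h1) (t h2) (ih _ ?_ a e.flip rfl h1)
          (ih _ ?_ e.flip b rfl h2)
        · simp only [Chord.flip]; omega
        · simp only [Chord.flip]; omega
    · obtain ⟨e, rfl⟩ := hP w (mem_capSet.1 hw).1
      obtain ⟨h1, h2⟩ := h.insert hS hCS hC hC0 hτ hw
      exact h.step hS hCS hC0 hτ h1 h2 (t h) (t h1) (t h2)
        (ih _ (h.card_lt hS hCS hC hC0 hF hP hτ h1 h2 hw) a e rfl h1)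
        (ih _ (h.card_lt_right hS hCS hC hC0 hF hP hτ h1 h2 hw) e b rfl h2)

end

end SphericalPolygon

/-! ### The metric estimate for two vertices. -/

namespace SphericalPolygon

open InnerProductGeometry

variable {P : Finset E3} {C S τ : ℝ} {a b e : Chord P C S}

/-- In the application `x`, `y`, `z` are the coordinates of `b.p` along `a.q`, a unit normal of the
plane of `a`, and `a.d`, while `g = ⟪a.p, b.p⟫`. If `g ≤ C k`, the projection of `b.p` to that plane
has length `X ≤ k`; so `x ≤ k` and `y² ≥ 1 - k²`, and `h` becomes an inequality between `C` and `k`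
that fails. -/
theorem false_of_bounds {C S k x y z g : ℝ} (hS : 0 < S) (hC : 0 < C)
    (hCS : C ^ 2 + S ^ 2 = 1) (hk : 0 ≤ k) (hk2 : k ^ 2 = 1 - √2 / 2 * S)
    (hz : 0 ≤ z) (hxz : 0 ≤ S * x - C * z) (hg : g = C * x + S * z)
    (hn : x ^ 2 + y ^ 2 + z ^ 2 = 1) (hCx : C ≤ x)
    (h : y ^ 2 * (1 - g) ≤ (x - C) ^ 2 * (1 + g)) : C * k < g := by
  by_contra hcon
  push Not at hcon
  have hC1 : C < 1 := by nlinarith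
  have hm2 : (√2 / 2 * S) ^ 2 = S ^ 2 / 2 := by
    rw [mul_pow, div_pow, Real.sq_sqrt (by norm_num)]; ring
  have hm : 0 < √2 / 2 * S := by positivity
  set m := √2 / 2 * S with hmdef
  have hk1 : k < 1 := by nlinarith
  -- The factorization in `hfinal` reduces it to `2k² - 1 < C k`; here `k² = 1 - m` and `C² = 1 -
  -- 2m²`.
  have hCk : 1 - 2 * m < C * k := by
    by_contra hc
    push Not at hc
    have h0 := mul_nonneg hC.le hk
    have h1 : (C * k) ^ 2 ≤ (1 - 2 * m) ^ 2 := pow_le_pow_left₀ h0 hc 2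
    rw [mul_pow, hk2] at h1
    have : C ^ 2 = 1 - 2 * m ^ 2 := by linarith
    rw [this] at h1
    have : 0 < m * (3 - 6 * m + 2 * m ^ 2) := by
      apply mul_pos hm; nlinarith
    nlinarith
  have hfinal : (k - C) ^ 2 * (1 + C * k) < (1 - k ^ 2) * (1 - C * k) := by
    have e : (k - C) ^ 2 * (1 + C * k) - (1 - k ^ 2) * (1 - C * k)
      = (1 - C ^ 2) * (2 * k ^ 2 - C * k - 1) := by ring
    have : 0 < (1 - C ^ 2) * -(2 * k ^ 2 - C * k - 1) := by
      apply mul_pos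
      · rw [show 1 - C ^ 2 = S ^ 2 by linarith]; positivity
      · rw [hk2]; linarith
    linarith
  have hx0 : 0 < x := hC.trans_le hCx
  obtain ⟨X, hX0, hX2⟩ : ∃ X : ℝ, 0 ≤ X ∧ X ^ 2 = x ^ 2 + z ^ 2 :=
    ⟨√(x ^ 2 + z ^ 2), Real.sqrt_nonneg _, Real.sq_sqrt (by positivity)⟩
  have hxX : x ≤ X := abs_le_of_sq_le_sq' (by nlinarith) hX0 |>.2
  -- The projection of `b.p` points between `a.q` and `a.p`, so its angle with `a.p` has cosine at
  -- least `C`.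
  have hgX : C * X ≤ g := by
    have hg0 : 0 ≤ g := by rw [hg]; positivity
    refine abs_le_of_sq_le_sq' ?_ hg0 |>.2
    rw [mul_pow, hX2, hg]
    have h1 := mul_nonneg hz (mul_nonneg hC.le hxz)
    have h2 : 0 ≤ z * (C * S * x + S ^ 2 * z) := by positivity
    linarith
  have hXk : X ≤ k := le_of_mul_le_mul_left (hgX.trans hcon) hC
  have hg1 : g ≤ 1 := hcon.trans (by nlinarith)
  have s1 : (1 - k ^ 2) * (1 - C * k) ≤ y ^ 2 * (1 - g) := by
    apply mul_le_mul
    · have := pow_le_pow_left₀ hX0 hXk 2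
      linarith
    · linarith
    · nlinarith
    · positivity
  have s2 : (x - C) ^ 2 * (1 + g) ≤ (k - C) ^ 2 * (1 + C * k) := by
    apply mul_le_mul
    · exact pow_le_pow_left₀ (by linarith) (by linarith) 2
    · linarith
    · have := mul_nonneg hC.le hX0; linarith
    · positivity
  linarith

section

variable (hS : 0 < S) (hCS : C ^ 2 + S ^ 2 = 1) (hC0 : 0 < C)
include hS hCS hC0

/-- By `hle` the leg from `a.q` to `A` is the longer one, so `|a.p b.p|` is at most twice it, and
the tangent of that leg is `β / α`. On the other hand `⟪b.p, A⟫ = C ⟪b.q, A⟫ ≥ C α` reads `y β ≤ (x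
- C) α`. Eliminating `β / α` gives the last hypothesis of `false_of_bounds`. -/
theorem Ord.inner_gt_aux (hτ : τ ^ 2 = 1) (h : Ord τ a b) (hp : 0 ≤ ⟪a.d, b.p⟫)
    (hstar : angle a.p b.p ≤ angle a.q (τ • cross a.d b.d) + angle (τ • cross a.d b.d) b.q)
    (hle : ⟪a.q, τ • cross a.d b.d⟫ ≤ ⟪b.q, τ • cross a.d b.d⟫) {k : ℝ} (hk : 0 ≤ k)
    (hk2 : k ^ 2 = 1 - √2 / 2 * S) : C * k < ⟪a.p, b.p⟫ := by
  have dA : ⟪a.d, τ • cross a.d b.d⟫ = 0 := by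
    rw [real_inner_comm, inner_cross, tdet_self]
  have bA : ⟪b.d, τ • cross a.d b.d⟫ = 0 := by
    rw [real_inner_comm, inner_cross, tdet_self_right]
  have tA : tdet τ a.p a.q (τ • cross a.d b.d) = S * ⟪b.d, a.q⟫ := by
    rw [tdet_cross hτ, real_inner_comm a.d a.q, real_inner_comm a.d a.p, a.dq hS, a.dp hS hCS,
      real_inner_comm b.d a.q]
    ring
  have hα : S ^ 2 * ⟪a.q, τ • cross a.d b.d⟫
      = C * tdet τ a.p a.q b.q - tdet τ a.p a.q b.p := by
    have e1 := a.tdet_d τ a.q b.d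
    have e2 := b.tdet_d τ a.p a.q
    rw [real_inner_comm, inner_cross]
    have e3 : tdet τ a.q b.d a.d = tdet τ a.d a.q b.d := by rw [← tdet_rot]
    have e4 : tdet τ a.q b.d a.p = tdet τ a.p a.q b.d := by rw [← tdet_rot]
    have e5 : tdet τ a.q b.d a.q = 0 := tdet_self _ _ _
    have e6 : tdet τ a.d b.d a.q = - tdet τ a.d a.q b.d := by
      rw [← tdet_rot, tdet_swap]
    rw [e3, e4, e5] at e1
    rw [e6]
    linear_combination (-S) * e1 - e2
  set A := τ • cross a.d b.d
  set α := ⟪a.q, A⟫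
  set β := ⟪b.d, a.q⟫ with hβ
  have hβ0 : 0 ≤ β := a.hq _ b.hd
  have pA : ⟪a.p, A⟫ = C * α := by
    have := a.inner_d A
    rw [dA] at this
    linarith
  have cA : S * ⟪a.c, A⟫ = S ^ 2 * α := by
    rw [a.inner_c, pA]
    linear_combination (-α) * hCS
  have AA : ⟪A, A⟫ = α ^ 2 + β ^ 2 := by
    have := a.decomp hτ hCS A A
    rw [dA, cA, tA, real_inner_comm a.q A] at this
    have : S ^ 2 * (⟪A, A⟫ - (α ^ 2 + β ^ 2)) = 0 := by linear_combination this
    have := (mul_eq_zero.1 this).resolve_left (by positivity)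
    linarith
  have hα0 : 0 < α := by
    have h1 : 0 < C * tdet τ a.p a.q b.q - tdet τ a.p a.q b.p := by
      obtain ⟨h1, h2, h3⟩ := h
      rcases h1.eq_or_lt with h0 | h0
      · have := mul_pos hC0 (show 0 < tdet τ a.p a.q b.q by linarith)
        linarith
      · have := mul_nonneg hC0.le h2
        linarith
    rw [← hα] at h1
    exact pos_of_mul_pos_right h1 (by positivity)
  obtain ⟨y, hy⟩ : ∃ y : ℝ, S * y = - tdet τ a.p a.q b.p :=
    ⟨- tdet τ a.p a.q b.p / S, by field_simp⟩
  have hy0 : 0 ≤ y := by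
    have : 0 ≤ S * y := by rw [hy]; linarith [h.1]
    exact nonneg_of_mul_nonneg_right this hS
  have hz := a.inner_d b.p
  have hc := a.inner_c b.p
  have hc0 := b.hp _ a.hc
  set x := ⟪a.q, b.p⟫ with hx
  set z := ⟪a.d, b.p⟫
  set g := ⟪a.p, b.p⟫
  have hg : g = C * x + S * z := by linarith
  have hxA : (x - C) * α ≥ y * β := by
    have e1 := b.inner_d A
    rw [bA] at e1
    have e2 := a.decomp hτ hCS A b.p
    rw [dA, cA, tA, real_inner_comm a.q b.p, ← hx] at e2
    have e3 : S ^ 2 * (⟪b.p, A⟫ - (α * x - β * y)) = 0 := by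
      linear_combination e2 + S * β * hy
    have e3 := (mul_eq_zero.1 e3).resolve_left (by positivity)
    have := mul_le_mul_of_nonneg_left hle hC0.le
    linarith
  have hCx : C ≤ x := by
    have : 0 ≤ (x - C) * α := (mul_nonneg hy0 hβ0).trans hxA
    have := nonneg_of_mul_nonneg_left this hα0
    linarith
  have hn : x ^ 2 + y ^ 2 + z ^ 2 = 1 := by
    have e2 := a.decomp hτ hCS b.p b.p
    rw [real_inner_comm a.q b.p, real_inner_comm a.p b.p, ← hx, b.pp, hc] at e2
    have : S ^ 2 * (x ^ 2 + y ^ 2 + z ^ 2 - 1) = 0 := by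
      rw [show tdet τ a.p a.q b.p = - (S * y) by linarith] at e2
      change S ^ 2 * 1 = S * z * g + (x - C * g) * x + _ at e2
      rw [hg] at e2
      linear_combination (-e2) + x ^ 2 * hCS
    have := (mul_eq_zero.1 this).resolve_left (by positivity)
    linarith
  have hxz : 0 ≤ S * x - C * z := by
    have : S * ⟪a.c, b.p⟫ = S * (S * x - C * z) := by
      rw [hc, hg]; linear_combination (-x) * hCS
    rw [← mul_left_cancel₀ hS.ne' this]
    exact hc0
  refine false_of_bounds hS hC0 hCS hk hk2 hp hxz hg hn hCx ?_
  have nA : ‖A‖ ^ 2 = α ^ 2 + β ^ 2 := by rw [← real_inner_self_eq_norm_sq, AA]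
  have nA0 : 0 < ‖A‖ := by
    rcases (norm_nonneg A).eq_or_lt with h0 | h0
    · rw [← h0] at nA; nlinarith
    · exact h0
  have hang : angle A b.q ≤ angle a.q A := by
    rw [angle_comm]
    unfold angle
    rw [norm_eq_one a.qq, norm_eq_one b.qq]
    apply Real.arccos_le_arccos
    gcongr
  have hcos : Real.cos (angle a.q A) = α / ‖A‖ := by
    rw [cos_angle, norm_eq_one a.qq, one_mul]
  have hpi : angle a.q A ≤ Real.pi / 2 := by
    by_contra hc
    push Not at hc
    have := Real.cos_neg_of_pi_div_two_lt_of_lt hc (by linarith [angle_le_pi a.q A, Real.pi_pos])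
    rw [hcos] at this
    have : 0 < α / ‖A‖ := by positivity
    linarith
  have h2 : Real.cos (2 * angle a.q A) ≤ Real.cos (angle a.p b.p) :=
    Real.cos_le_cos_of_nonneg_of_le_pi (angle_nonneg _ _) (by linarith) (by linarith)
  rw [cos_angle, norm_eq_one a.pp, norm_eq_one b.pp, Real.cos_two_mul, hcos, div_pow, nA] at h2
  have h3 : α ^ 2 * (1 - g) ≤ β ^ 2 * (1 + g) := by
    have h2 : 2 * (α ^ 2 / (α ^ 2 + β ^ 2)) - 1 ≤ g := by simpa using h2
    have : α ^ 2 / (α ^ 2 + β ^ 2) ≤ (1 + g) / 2 := by linarith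
    rw [div_le_iff₀ (by positivity)] at this
    linarith
  have hg1 : 0 ≤ 1 + g := by rw [hg]; have : 0 ≤ x := hC0.le.trans hCx; positivity
  have h4 : (y * β) ^ 2 ≤ ((x - C) * α) ^ 2 :=
    pow_le_pow_left₀ (mul_nonneg hy0 hβ0) hxA 2
  have h5 := mul_le_mul_of_nonneg_right h4 hg1
  have h6 := mul_le_mul_of_nonneg_left h3 (sq_nonneg y)
  refine le_of_mul_le_mul_left (a := α ^ 2) ?_ (by positivity)
  linarith

theorem inner_gt
    (hF : ∀ u ∈ dualCone P, ∀ v ∈ dualCone P, ⟪u, u⟫ = ⟪v, v⟫ → -C * ⟪u, u⟫ ≤ ⟪u, v⟫)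
    (hP : ∀ w ∈ P, ∃ x : Chord P C S, x.p = w) {k : ℝ} (hk : 0 ≤ k)
    (hk2 : k ^ 2 = 1 - √2 / 2 * S) {v w : E3} (hv : v ∈ P) (hw : w ∈ P) : C * k < ⟪v, w⟫ := by
  have hC : C < 1 := by nlinarith
  have hk1 : k < 1 := by
    have : 0 < √2 / 2 * S := by positivity
    nlinarith
  have key : ∀ {τ : ℝ}, τ ^ 2 = 1 → ∀ {a b : Chord P C S}, a.p ∈ P → b.p ∈ P → Ord τ a b →
      C * k < ⟪a.p, b.p⟫ := by
    intro τ hτ a b ha hb h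
    have hstar := h.angle_le hS hCS hC hC0 hF hP hτ
    rcases le_total ⟪a.q, τ • cross a.d b.d⟫ ⟪b.q, τ • cross a.d b.d⟫ with hle | hle
    · exact h.inner_gt_aux hS hCS hC0 hτ (a.hd _ hb) hstar hle hk hk2
    · have e : (-τ) • cross b.d a.d = τ • cross a.d b.d := by
        rw [cross_swap b.d a.d, smul_neg, neg_smul, neg_neg]
      rw [real_inner_comm]
      refine (h.symm hS hCS).inner_gt_aux hS hCS hC0 (neg_sq_one hτ) (b.hd _ ha) ?_ ?_ hk hk2
      · rw [e, angle_comm, angle_comm b.q, angle_comm _ a.q, add_comm]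
        exact hstar
      · rw [e]; exact hle
  obtain ⟨a, rfl⟩ := hP v hv
  obtain ⟨b, rfl⟩ := hP w hw
  -- Coplanar chords are not ordered, but then `b.p` lies on the arc from `a.p` to `a.q`, whence
  -- `⟪a.p, b.p⟫ ≥ C`.
  by_cases h : tdet 1 a.p a.q b.p = 0 ∧ tdet 1 a.p a.q b.q = 0
  · rw [real_inner_comm]
    have hz := a.inner_d b.p
    have hc := a.inner_c b.p
    have hd0 := mul_nonneg hS.le (b.hp _ a.hd)
    have hc0 := mul_nonneg hS.le (b.hp _ a.hc)
    have e2 := a.decomp (one_pow 2) hCS b.p b.p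
    rw [real_inner_comm a.q b.p, real_inner_comm a.p b.p, b.pp, h.1, hc, hz] at e2
    rw [hz] at hd0
    rw [hc] at hc0
    rw [real_inner_comm a.p b.p]
    set g := ⟪a.p, b.p⟫
    set x := ⟪a.q, b.p⟫
    have hx0 : 0 ≤ x := by
      have := mul_nonneg hC0.le hd0
      have : 0 ≤ S ^ 2 * x := by rw [show S ^ 2 = 1 - C ^ 2 by linarith]; linarith
      exact nonneg_of_mul_nonneg_right this (by positivity)
    have hg0 : 0 ≤ g := by have := mul_nonneg hC0.le hx0; linarith
    have hgC : C ≤ g := by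
      refine abs_le_of_sq_le_sq' ?_ hg0 |>.2
      have h1 := mul_nonneg hd0 (mul_nonneg hC0.le hc0)
      have h2 : 0 ≤ (g - C * x) * g := mul_nonneg hd0 hg0
      have h3 : S ^ 2 * (g ^ 2 - C ^ 2)
          = S ^ 2 * ((g - C * x) * g) + (g - C * x) * (C * (x - C * g)) := by
        linear_combination (-C ^ 2) * e2 + C * g * x * hCS
      have h4 : 0 ≤ S ^ 2 * (g ^ 2 - C ^ 2) := by rw [h3]; positivity
      have := nonneg_of_mul_nonneg_right h4 (by positivity)
      linarith
    have : 0 < C * (1 - k) := mul_pos hC0 (by linarith)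
    linarith
  · rcases ord_or_ord hS hCS hC hC0 (one_pow 2) h with h | h
    · exact key (one_pow 2) hv hw h
    · rw [real_inner_comm]
      exact key (one_pow 2) hw hv h

end

end SphericalPolygon

/-! ### Spherically convex sets as central projections of convex sets. -/

namespace SphericalPolygon

open InnerProductGeometry

/-- The central projection of a set to the sphere. -/
def central (K : Set E3) : Set S2 := {x | ∃ r : ℝ, 0 < r ∧ r • (x : E3) ∈ K}

theorem norm_coe (x : S2) : ‖(x : E3)‖ = 1 := by simp

theorem inner_coe_self (x : S2) : ⟪(x : E3), (x : E3)⟫ = 1 := by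
  rw [real_inner_self_eq_norm_sq, norm_coe]; norm_num

theorem coe_ne_zero (x : S2) : (x : E3) ≠ 0 := fun h => by
  have := norm_coe x
  rw [h, norm_zero] at this
  exact zero_ne_one this

theorem sdist_eq_arccos (x y : S2) : sdist x y = Real.arccos ⟪(x : E3), (y : E3)⟫ := by
  unfold sdist angle
  rw [norm_coe, norm_coe, mul_one, div_one]

theorem sdist_lt_pi {x y : S2} : sdist x y < Real.pi ↔ (x : E3) ≠ -(y : E3) := by
  rw [sdist, (angle_le_pi _ _).lt_iff_ne, not_iff_not, angle_eq_pi_iff]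
  constructor
  · rintro ⟨-, r, hr, h⟩
    have h1 := congrArg norm h
    rw [norm_smul, norm_coe, norm_coe, mul_one, Real.norm_eq_abs, abs_of_neg hr] at h1
    rw [h, show r = -1 by linarith]; simp
  · intro h
    exact ⟨coe_ne_zero x, -1, by norm_num, by rw [h]; simp⟩

/-- The point of the sphere in the direction of a nonzero vector. -/
noncomputable def direction (x : E3) (hx : x ≠ 0) : S2 :=
  ⟨‖x‖⁻¹ • x, by
    rw [mem_sphere_zero_iff_norm, norm_smul, norm_inv, norm_norm,
      inv_mul_cancel₀ (norm_ne_zero_iff.2 hx)]⟩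

theorem norm_smul_direction {x : E3} (hx : x ≠ 0) : ‖x‖ • (direction x hx : E3) = x := by
  rw [direction, smul_smul, mul_inv_cancel₀ (norm_ne_zero_iff.2 hx), one_smul]

theorem eq_of_smul_eq {x y : S2} {r s : ℝ} (hr : 0 < r) (hs : 0 < s)
    (h : r • (x : E3) = s • (y : E3)) : x = y := by
  have h1 := congrArg norm h
  rw [norm_smul, norm_smul, norm_coe, norm_coe, mul_one, mul_one, Real.norm_eq_abs,
    Real.norm_eq_abs, abs_of_pos hr, abs_of_pos hs] at h1
  rw [h1] at h
  exact Subtype.ext (smul_right_injective _ hs.ne' h)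

theorem mem_central_of_mem {K : Set E3} {x : S2} (h : (x : E3) ∈ K) : x ∈ central K :=
  ⟨1, one_pos, by rwa [one_smul]⟩

theorem smul_add_smul_mem {K : Set E3} (hK : Convex ℝ K) {x y : E3} (hx : x ∈ K) (hy : y ∈ K)
    {r s : ℝ} (hr : 0 ≤ r) (hs : 0 ≤ s) (h : 0 < r + s) : ∃ z ∈ K, r • x + s • y = (r + s) • z := by
  refine ⟨(r / (r + s)) • x + (s / (r + s)) • y, hK hx hy (by positivity) (by positivity)
    (by field_simp), ?_⟩
  rw [smul_add, smul_smul, smul_smul, mul_div_cancel₀ _ h.ne', mul_div_cancel₀ _ h.ne']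

theorem isConvex_central {K : Set E3} (hK : Convex ℝ K) (h0 : (0 : E3) ∉ K) :
    IsConvex (central K) := by
  rintro x ⟨r, hr, hx⟩ y ⟨s, hs, hy⟩
  refine ⟨sdist_lt_pi.2 fun h => h0 ?_, ?_⟩
  · obtain ⟨z, hz, e⟩ := smul_add_smul_mem hK hx hy (inv_pos.2 hr).le (inv_pos.2 hs).le
      (by positivity)
    rw [smul_smul, smul_smul, inv_mul_cancel₀ hr.ne', inv_mul_cancel₀ hs.ne', one_smul, one_smul,
      h, neg_add_cancel] at e
    have : z = 0 := (smul_eq_zero.1 e.symm).resolve_left (by positivity)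
    rwa [← this]
  · rintro z ⟨a, b, ha, hb, hz⟩
    have hab : 0 < a * r⁻¹ + b * s⁻¹ := by
      rcases ha.eq_or_lt with h | h
      · rcases hb.eq_or_lt with h' | h'
        · rw [← h, ← h'] at hz
          simp [coe_ne_zero] at hz
        · positivity
      · positivity
    obtain ⟨u, hu, e⟩ := smul_add_smul_mem hK hx hy (r := a * r⁻¹) (s := b * s⁻¹) (by positivity)
      (by positivity) hab
    rw [smul_smul, smul_smul, mul_assoc, mul_assoc, inv_mul_cancel₀ hr.ne',
      inv_mul_cancel₀ hs.ne', mul_one, mul_one, ← hz] at e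
    refine ⟨_, inv_pos.2 hab, ?_⟩
    rwa [e, smul_smul, inv_mul_cancel₀ hab.ne', one_smul]

theorem isClosed_central {K : Set E3} (hK : IsCompact K) (h0 : (0 : E3) ∉ K) :
    IsClosed (central K) := by
  have h : central K = (fun x : S2 => (x : E3)) ⁻¹' ((fun x : E3 => ‖x‖⁻¹ • x) '' K) := by
    ext x
    constructor
    · rintro ⟨r, hr, hx⟩
      refine ⟨_, hx, ?_⟩
      simp only [norm_smul, norm_coe, mul_one, Real.norm_eq_abs, abs_of_pos hr, smul_smul,
        inv_mul_cancel₀ hr.ne', one_smul]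
    · rintro ⟨y, hy, e⟩
      have hy0 : y ≠ 0 := fun h => h0 (h ▸ hy)
      refine ⟨‖y‖, norm_pos_iff.2 hy0, ?_⟩
      simp only at e
      rw [← e]
      simpa [smul_smul, mul_inv_cancel₀ (norm_ne_zero_iff.2 hy0)] using hy
  rw [h]
  refine ((hK.image_of_continuousOn ?_).isClosed).preimage continuous_subtype_val
  refine ContinuousOn.smul (ContinuousOn.inv₀ continuous_norm.continuousOn fun x hx => ?_)
    continuousOn_id
  exact norm_ne_zero_iff.2 fun h => h0 (h ▸ hx)

/-- With the origin adjoined, the hull of `G` has an interior point `y ≠ 0`; all directions near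
that of `y` then meet the hull of `G` itself. -/
theorem interior_central_nonempty {G : Set E3} (hG : Submodule.span ℝ G = ⊤) (hne : G.Nonempty) :
    (interior (central (convexHull ℝ G))).Nonempty := by
  have h1 : affineSpan ℝ (insert (0 : E3) G) = ⊤ := by
    rw [← AffineSubspace.coe_eq_univ_iff, affineSpan_insert_zero, hG, Submodule.top_coe]
  have h2 := interior_convexHull_nonempty_iff_affineSpan_eq_top.2 h1
  obtain ⟨y, hy, hy0⟩ := (dense_compl_singleton (0 : E3)).inter_open_nonempty _ isOpen_interior h2
  have hy0 : y ≠ 0 := hy0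
  refine ⟨direction y hy0, mem_interior.2 ⟨(fun x : S2 => ‖y‖ • (x : E3)) ⁻¹'
    (interior (convexHull ℝ (insert 0 G)) ∩ ({0}ᶜ : Set E3)), ?_, ?_, ?_⟩⟩
  · rintro x ⟨hx, hx0⟩
    have hx := interior_subset hx
    rw [convexHull_insert hne, convexJoin_singleton_left, Set.mem_iUnion₂] at hx
    obtain ⟨g, hg, hx⟩ := hx
    obtain ⟨a, b, ha, hb, hab, e⟩ := hx
    rw [smul_zero, zero_add] at e
    have hb0 : 0 < b := hb.lt_of_ne fun h => by
      rw [← h, zero_smul] at e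
      exact hx0 e.symm
    refine ⟨b⁻¹ * ‖y‖, mul_pos (inv_pos.2 hb0) (norm_pos_iff.2 hy0), ?_⟩
    simp only at e
    rwa [mul_smul, ← e, smul_smul, inv_mul_cancel₀ hb0.ne', one_smul]
  · exact (isOpen_interior.inter (isOpen_compl_singleton (x := (0 : E3)))).preimage
      (by fun_prop : Continuous fun x : S2 => ‖y‖ • (x : E3))
  · simp only [Set.mem_preimage, norm_smul_direction]
    exact ⟨hy, hy0⟩

/-- The cone over a convex subset of the sphere, without its apex, is convex. -/
theorem convex_cone {D : Set S2} (hD : IsConvex D) :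
    Convex ℝ {v : E3 | ∃ r : ℝ, 0 < r ∧ ∃ x ∈ D, v = r • (x : E3)} := by
  rintro _ ⟨r, hr, x, hx, rfl⟩ _ ⟨s, hs, y, hy, rfl⟩ a b ha hb hab
  obtain ⟨h1, h2⟩ := hD x hx y hy
  rw [smul_smul, smul_smul]
  have har : 0 ≤ a * r := by positivity
  have hbs : 0 ≤ b * s := by positivity
  have hpos : 0 < a * r + b * s := by
    rcases ha.eq_or_lt with h | h
    · have : b = 1 := by linarith
      rw [this]; positivity
    · positivity
  have hne : (a * r) • (x : E3) + (b * s) • (y : E3) ≠ 0 := fun h => by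
    have e : (a * r) • (x : E3) = -((b * s) • (y : E3)) := eq_neg_of_add_eq_zero_left h
    have h3 := congrArg norm e
    rw [norm_neg, norm_smul, norm_smul, norm_coe, norm_coe, mul_one, mul_one, Real.norm_eq_abs,
      Real.norm_eq_abs, abs_of_nonneg har, abs_of_nonneg hbs] at h3
    rw [h3, ← smul_neg] at e
    exact sdist_lt_pi.1 h1 (smul_right_injective _ (by linarith : b * s ≠ 0) e)
  have hn := norm_pos_iff.2 hne
  refine ⟨_, hn, direction _ hne, h2 ⟨‖(a * r) • (x : E3) + (b * s) • (y : E3)‖⁻¹ * (a * r),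
    ‖(a * r) • (x : E3) + (b * s) • (y : E3)‖⁻¹ * (b * s), by positivity, by positivity, ?_⟩,
    (norm_smul_direction hne).symm⟩
  simp only [direction, smul_add, smul_smul]

theorem convexHull_subset_cone {A D : Set S2} (hD : IsConvex D) (h : A ⊆ D) :
    convexHull ℝ ((↑) '' A : Set E3) ⊆ {v : E3 | ∃ r : ℝ, 0 < r ∧ ∃ x ∈ D, v = r • (x : E3)} := by
  refine convexHull_min ?_ (convex_cone hD)
  rintro _ ⟨x, hx, rfl⟩
  exact ⟨1, one_pos, x, h hx, (one_smul _ _).symm⟩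

theorem zero_notMem_convexHull {A D : Set S2} (hD : IsConvex D) (h : A ⊆ D) :
    (0 : E3) ∉ convexHull ℝ ((↑) '' A : Set E3) := fun h0 => by
  obtain ⟨r, hr, x, -, e⟩ := convexHull_subset_cone hD h h0
  exact smul_ne_zero hr.ne' (coe_ne_zero x) e.symm

/-- The projection is itself spherically convex, and the cone over any convex set containing `A` is
convex, so it contains the linear hull of `A`. -/
theorem hull_eq_central {A D : Set S2} (hD : IsConvex D) (h : A ⊆ D) :
    hull A = central (convexHull ℝ ((↑) '' A : Set E3)) := by
  apply Set.Subset.antisymm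
  · exact Set.sInter_subset_of_mem ⟨isConvex_central (convex_convexHull ℝ _)
      (zero_notMem_convexHull hD h), fun x hx =>
      mem_central_of_mem (subset_convexHull ℝ _ ⟨x, hx, rfl⟩)⟩
  · rintro x ⟨r, hr, hx⟩ D' ⟨hD', h'⟩
    obtain ⟨s, hs, y, hy, e⟩ := convexHull_subset_cone hD' h' hx
    rwa [eq_of_smul_eq hr hs e]

/-- Farkas' lemma for the cone over a compact convex set. -/
theorem exists_smul_of_bidual {K : Set E3} (hK : IsCompact K) (hc : Convex ℝ K)
    (h0 : (0 : E3) ∉ K) {x : E3} (hx0 : x ≠ 0)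
    (hx : ∀ e : E3, (∀ y ∈ K, 0 ≤ ⟪e, y⟫) → 0 ≤ ⟪e, x⟫) : ∃ r : ℝ, 0 < r ∧ ∃ y ∈ K, x = r • y := by
  by_contra hcon
  push Not at hcon
  set T : Set E3 := (fun t : ℝ => t • x) '' Set.Ici 0
  have hTc : Convex ℝ T := by
    rintro _ ⟨t, ht, rfl⟩ _ ⟨s, hs, rfl⟩ a b ha hb hab
    refine ⟨a * t + b * s, ?_, by simp only [add_smul, mul_smul]⟩
    have ht : 0 ≤ t := ht
    have hs : 0 ≤ s := hs
    exact show 0 ≤ a * t + b * s by positivity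
  have hTcl : IsClosed T := (isClosedEmbedding_smul_left hx0).isClosedMap _ isClosed_Ici
  have hd : Disjoint K T := by
    rw [Set.disjoint_left]
    rintro _ hy ⟨t, ht, rfl⟩
    rcases (show (0 : ℝ) ≤ t from ht).eq_or_lt with h | h
    · rw [← h] at hy
      simp only [zero_smul] at hy
      exact h0 hy
    · refine hcon t⁻¹ (inv_pos.2 h) _ hy ?_
      simp only [smul_smul, inv_mul_cancel₀ h.ne', one_smul]
  obtain ⟨f, u, v, h1, h2, h3⟩ := geometric_hahn_banach_compact_closed hc hK hTc hTcl hd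
  have hv : v < 0 := by
    have := h3 0 ⟨0, by simp, by simp⟩
    simpa using this
  have hfx : 0 ≤ f x := by
    by_contra hneg
    push Not at hneg
    have := h3 ((v / f x) • x) ⟨v / f x, (div_pos_of_neg_of_neg hv hneg).le, rfl⟩
    rw [map_smul, smul_eq_mul, div_mul_cancel₀ _ hneg.ne] at this
    exact lt_irrefl _ this
  obtain ⟨B, hB⟩ := hK.isBounded.exists_norm_le
  have hx1 : 0 < ‖x‖ := norm_pos_iff.2 hx0
  have hB1 : 0 < |B| + 1 := by positivity
  -- The functional `f` may vanish at `x`. Adding `δ • x` makes it positive there, and `δ ⟪x, y⟫ ≤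
  -- -v` keeps it negative on `K`.
  set δ := -v / (‖x‖ * (|B| + 1)) with hδ
  have hδ0 : 0 < δ := by have := neg_pos.2 hv; positivity
  set e : E3 := (InnerProductSpace.toDual ℝ E3).symm f with he
  have hf : ∀ y, ⟪e, y⟫ = f y := fun y => by rw [he, InnerProductSpace.toDual_symm_apply]
  have key := hx (-(e + δ • x)) fun y hy => by
    rw [inner_neg_left, inner_add_left, inner_smul_left, hf]
    have b1 := h1 y hy
    have b2 : ⟪x, y⟫ ≤ ‖x‖ * (|B| + 1) :=
      (real_inner_le_norm x y).trans (mul_le_mul_of_nonneg_left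
        ((hB y hy).trans ((le_abs_self B).trans (by linarith))) hx1.le)
    have b3 := mul_le_mul_of_nonneg_left b2 hδ0.le
    rw [hδ, div_mul_cancel₀ _ (by positivity), ← hδ] at b3
    simp only [conj_trivial]
    linarith
  rw [inner_neg_left, inner_add_left, inner_smul_left, hf] at key
  have := mul_pos hδ0 (real_inner_self_pos.2 hx0)
  simp only [conj_trivial] at key
  linarith

/-- A subset of the sphere with nonempty interior is not contained in a great circle. -/
theorem eq_zero_of_inner_eq_zero {V : Set S2} (hV : (interior V).Nonempty) {n : E3}
    (h : ∀ x ∈ V, ⟪n, (x : E3)⟫ = 0) : n = 0 := by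
  obtain ⟨x, hx⟩ := hV
  by_contra hn
  have hxn : ⟪n, (x : E3)⟫ = 0 := h x (interior_subset hx)
  have ne : ∀ t : ℝ, (x : E3) + t • n ≠ 0 := fun t h0 => by
    have h1 := congrArg (fun v => ⟪(x : E3), v⟫) h0
    simp only [inner_add_right, inner_smul_right, inner_coe_self, inner_zero_right] at h1
    rw [real_inner_comm, hxn] at h1
    linarith
  have hcont : Continuous fun t : ℝ => direction ((x : E3) + t • n) (ne t) := by
    refine Continuous.subtype_mk ?_ _
    refine Continuous.smul (Continuous.inv₀ (by fun_prop) fun t => norm_ne_zero_iff.2 (ne t)) ?_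
    fun_prop
  have h0 : direction ((x : E3) + (0 : ℝ) • n) (ne 0) = x := by
    apply Subtype.ext
    simp [direction]
  have hmem : (fun t : ℝ => direction ((x : E3) + t • n) (ne t)) ⁻¹' interior V ∈ nhds (0 : ℝ) :=
    hcont.continuousAt.preimage_mem_nhds (by rw [h0]; exact isOpen_interior.mem_nhds hx)
  obtain ⟨ε, hε, hball⟩ := Metric.mem_nhds_iff.1 hmem
  have hm : ε / 2 ∈ Metric.ball (0 : ℝ) ε := by
    rw [Metric.mem_ball, Real.dist_eq, sub_zero, abs_of_pos (by positivity)]; linarith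
  have h2 := h _ (interior_subset (hball hm))
  have h3 : ⟪n, (x : E3) + (ε / 2) • n⟫ = 0 := by
    rw [← norm_smul_direction (ne (ε / 2)), inner_smul_right, h2, mul_zero]
  rw [inner_add_right, inner_smul_right, hxn, zero_add] at h3
  have := mul_pos (half_pos hε) (real_inner_self_pos.2 hn)
  linarith

end SphericalPolygon

/-! ### Thickness in terms of the polar cone. -/

namespace SphericalPolygon

open InnerProductGeometry

/-- The polar cone of a subset of the sphere. -/
def polar (V : Set S2) : Set E3 := {e | ∀ x ∈ V, 0 ≤ ⟪e, (x : E3)⟫}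

theorem mem_hemisphere {c x : S2} : x ∈ hemisphere c ↔ 0 ≤ ⟪(c : E3), (x : E3)⟫ := by
  rw [hemisphere, Set.mem_ofPred_eq, sdist_eq_arccos, Real.arccos_le_pi_div_two]

theorem subset_lune {V : Set S2} {c d : S2} :
    V ⊆ hemisphere c ∩ hemisphere d ↔ (c : E3) ∈ polar V ∧ (d : E3) ∈ polar V := by
  rw [Set.subset_inter_iff]
  simp only [Set.subset_def, mem_hemisphere, polar, Set.mem_ofPred_eq]

theorem mem_luneSide {c d x : S2} :
    x ∈ luneSide c d ↔ ⟪(c : E3), (x : E3)⟫ = 0 ∧ 0 ≤ ⟪(d : E3), (x : E3)⟫ := by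
  rw [luneSide, Set.mem_ofPred_eq, Set.mem_inter_iff, mem_hemisphere, mem_hemisphere,
    sdist_eq_arccos, Real.arccos_eq_pi_div_two]
  constructor
  · rintro ⟨h1, -, h2⟩
    exact ⟨h1, h2⟩
  · rintro ⟨h1, h2⟩
    exact ⟨h1, h1.ge, h2⟩

theorem inner_sub_smul_self (c d : S2) :
    ⟪(d : E3) - ⟪(c : E3), (d : E3)⟫ • (c : E3), (d : E3) - ⟪(c : E3), (d : E3)⟫ • (c : E3)⟫
      = 1 - ⟪(c : E3), (d : E3)⟫ ^ 2 := by
  simp only [inner_sub_left, inner_sub_right, inner_smul_left, inner_smul_right, conj_trivial,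
    inner_coe_self, real_inner_comm (c : E3) (d : E3)]
  ring

theorem inner_sq_lt_one {c d : S2} (h1 : c ≠ d) (h2 : c ≠ -d) :
    ⟪(c : E3), (d : E3)⟫ ^ 2 < 1 := by
  have h := inner_sub_smul_self c d
  have hne : (d : E3) - ⟪(c : E3), (d : E3)⟫ • (c : E3) ≠ 0 := fun h0 => by
    rw [h0, inner_zero_left] at h
    have h0 := sub_eq_zero.1 h0
    rcases sq_eq_one_iff.1 (show ⟪(c : E3), (d : E3)⟫ ^ 2 = 1 by linarith) with h' | h' <;> rw [h'] at h0
    · exact h1 (Subtype.ext (by rw [h0, one_smul]))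
    · exact h2 (Subtype.ext (by rw [coe_neg_sphere, h0, neg_smul, one_smul, neg_neg]))
  have := real_inner_self_pos.2 hne
  linarith

theorem cross_cross (x y : E3) : cross x (cross x y) = ⟪x, y⟫ • x - ⟪x, x⟫ • y := by
  simp only [inner_coord]
  ext i
  fin_cases i <;> simp [cross] <;> ring

/-- The corners of the lune, in the directions `±(c × d)`, belong to the side; a point within `π /
2` of both is orthogonal to `c × d`. So the center is the unit vector of the plane of `c`, `d`
orthogonal to `c`, on the side of `d`. -/
theorem semicircle_center {c d p : S2} (h1 : c ≠ d) (h2 : c ≠ -d) :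
    IsSemicircleCenter p (luneSide c d) ↔
      √(1 - ⟪(c : E3), (d : E3)⟫ ^ 2) • (p : E3) = (d : E3) - ⟪(c : E3), (d : E3)⟫ • (c : E3) := by
  have hk := inner_sq_lt_one h1 h2
  set k := ⟪(c : E3), (d : E3)⟫ with hkdef
  have hs : 0 < √(1 - k ^ 2) := Real.sqrt_pos.2 (by linarith)
  have hs2 : √(1 - k ^ 2) ^ 2 = 1 - k ^ 2 := Real.sq_sqrt (by linarith)
  have hdc : ⟪(d : E3), (c : E3)⟫ = k := by rw [real_inner_comm]
  constructor
  · rintro ⟨hp, hq⟩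
    obtain ⟨hcp, hdp⟩ := mem_luneSide.1 hp
    have hM : ∀ M : E3, ⟪(c : E3), M⟫ = 0 → ⟪(d : E3), M⟫ = 0 → 0 ≤ ⟪(p : E3), M⟫ := by
      intro M hc hd
      by_cases hM0 : M = 0
      · rw [hM0, inner_zero_right]
      have hn := norm_pos_iff.2 hM0
      have hmem : direction M hM0 ∈ luneSide c d := by
        rw [mem_luneSide]
        simp only [direction, inner_smul_right, hc, hd, mul_zero, le_refl, and_self]
      have := hq _ hmem
      rw [sdist_eq_arccos, Real.arccos_le_pi_div_two] at this
      rw [← norm_smul_direction hM0, inner_smul_right]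
      exact mul_nonneg hn.le this
    have c1 : ⟪(c : E3), cross c d⟫ = 0 := by
      have := inner_cross 1 c d c
      rwa [one_smul, tdet_self, real_inner_comm] at this
    have c2 : ⟪(d : E3), cross c d⟫ = 0 := by
      have := inner_cross 1 c d d
      rwa [one_smul, tdet_self_right, real_inner_comm] at this
    have c3 := hM _ c1 c2
    have c4 := hM (-cross c d) (by rw [inner_neg_right, c1, neg_zero])
      (by rw [inner_neg_right, c2, neg_zero])
    rw [inner_neg_right] at c4
    have c5 : ⟪cross (c : E3) d, (p : E3)⟫ = 0 := by rw [real_inner_comm]; linarith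
    have par := parallel_cross (c : E3) (cross c d) p hcp c5
    rw [cross_cross, ← hkdef, inner_coe_self, one_smul] at par
    have n1 : ⟪k • (c : E3) - (d : E3), k • (c : E3) - (d : E3)⟫ = 1 - k ^ 2 := by
      rw [← inner_neg_neg, neg_sub]
      exact inner_sub_smul_self c d
    have n2 : ⟪k • (c : E3) - (d : E3), (p : E3)⟫ = -⟪(d : E3), (p : E3)⟫ := by
      rw [inner_sub_left, inner_smul_left, hcp, mul_zero, zero_sub]
    rw [n1, n2, neg_smul, ← smul_neg, neg_sub] at par
    have n3 := congrArg (fun v => ⟪v, (d : E3)⟫) par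
    simp only [inner_smul_left, inner_sub_left, inner_coe_self, conj_trivial, ← hkdef] at n3
    rw [real_inner_comm (d : E3) (p : E3)] at n3
    have n4 : ⟪(d : E3), (p : E3)⟫ = √(1 - k ^ 2) := by
      have n5 := congrArg (fun v => ⟪v, (p : E3)⟫) par
      simp only [inner_smul_left, inner_sub_left, inner_coe_self, conj_trivial, hcp] at n5
      rw [eq_comm, Real.sqrt_eq_iff_mul_self_eq (by linarith) hdp]
      linarith
    rw [n4] at par
    apply smul_right_injective _ hs.ne'
    simp only
    rw [smul_smul, ← sq, hs2, par]
  · intro h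
    have e : ∀ x : E3, √(1 - k ^ 2) * ⟪x, (p : E3)⟫ = ⟪x, (d : E3)⟫ - k * ⟪x, (c : E3)⟫ := by
      intro x
      have := congrArg (fun v => ⟪x, v⟫) h
      simpa [inner_sub_right, inner_smul_right] using this
    refine ⟨mem_luneSide.2 ⟨?_, ?_⟩, fun q hq => ?_⟩
    · have := e c
      rw [inner_coe_self, mul_one, ← hkdef, sub_self] at this
      exact (mul_eq_zero.1 this).resolve_left hs.ne'
    · have := e d
      rw [inner_coe_self, hdc] at this
      exact nonneg_of_mul_nonneg_right (by rw [this]; nlinarith) hs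
    · obtain ⟨hcq, hdq⟩ := mem_luneSide.1 hq
      rw [sdist_eq_arccos, Real.arccos_le_pi_div_two]
      have := e q
      rw [real_inner_comm (c : E3), real_inner_comm (d : E3), hcq, mul_zero, sub_zero] at this
      rw [real_inner_comm]
      exact nonneg_of_mul_nonneg_right (by rw [this]; exact hdq) hs

theorem inner_centers {c d p q : S2} (h1 : c ≠ d) (h2 : c ≠ -d)
    (hp : IsSemicircleCenter p (luneSide c d)) (hq : IsSemicircleCenter q (luneSide d c)) :
    ⟪(p : E3), (q : E3)⟫ = -⟪(c : E3), (d : E3)⟫ := by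
  have hk := inner_sq_lt_one h1 h2
  rw [semicircle_center h1 h2] at hp
  rw [semicircle_center h1.symm (fun h => h2 (by rw [h, neg_neg])),
    real_inner_comm (c : E3) (d : E3)] at hq
  have hs2 : √(1 - ⟪(c : E3), (d : E3)⟫ ^ 2) * √(1 - ⟪(c : E3), (d : E3)⟫ ^ 2)
    = 1 - ⟪(c : E3), (d : E3)⟫ ^ 2 := Real.mul_self_sqrt (by linarith)
  have e : ⟪√(1 - ⟪(c : E3), (d : E3)⟫ ^ 2) • (p : E3), √(1 - ⟪(c : E3), (d : E3)⟫ ^ 2) • (q : E3)⟫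
      = (1 - ⟪(c : E3), (d : E3)⟫ ^ 2) * -⟪(c : E3), (d : E3)⟫ := by
    rw [hp, hq]
    simp only [inner_sub_left, inner_sub_right, inner_smul_left, inner_smul_right, conj_trivial,
      inner_coe_self, real_inner_comm (c : E3) (d : E3)]
    ring
  rw [inner_smul_left, inner_smul_right, conj_trivial, ← mul_assoc, hs2] at e
  exact mul_left_cancel₀ (by linarith) e

/-- The thicknesses of the lunes containing `V`, in terms of the centers of the hemispheres. -/
theorem lune_thicknesses (V : Set S2) :
    {δ | ∃ L : Set S2, IsLuneOfThickness L δ ∧ V ⊆ L} =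
      {δ | ∃ c d : S2, c ≠ d ∧ c ≠ -d ∧ (c : E3) ∈ polar V ∧ (d : E3) ∈ polar V ∧
        δ = Real.arccos (-⟪(c : E3), (d : E3)⟫)} := by
  ext δ
  constructor
  · rintro ⟨_, ⟨c, d, h1, h2, rfl, p, q, hp, hq, rfl⟩, hV⟩
    obtain ⟨hc, hd⟩ := subset_lune.1 hV
    exact ⟨c, d, h1, h2, hc, hd, by rw [sdist_eq_arccos, inner_centers h1 h2 hp hq]⟩
  · rintro ⟨c, d, h1, h2, hc, hd, rfl⟩
    refine ⟨_, ⟨c, d, h1, h2, rfl, ?_⟩, subset_lune.2 ⟨hc, hd⟩⟩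
    have ex : ∀ {c d : S2}, c ≠ d → c ≠ -d → ∃ p, IsSemicircleCenter p (luneSide c d) := by
      intro c d h1 h2
      have hk := inner_sq_lt_one h1 h2
      have hn := inner_sub_smul_self c d
      have hne : (d : E3) - ⟪(c : E3), (d : E3)⟫ • (c : E3) ≠ 0 := fun h0 => by
        rw [h0, inner_zero_left] at hn
        linarith
      refine ⟨direction _ hne, (semicircle_center h1 h2).2 ?_⟩
      rw [← hn, real_inner_self_eq_norm_sq, Real.sqrt_sq (norm_nonneg _), norm_smul_direction]
    obtain ⟨p, hp⟩ := ex h1 h2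
    obtain ⟨q, hq⟩ := ex h1.symm fun h => h2 (by rw [h, neg_neg])
    exact ⟨p, q, hp, hq, by rw [sdist_eq_arccos, inner_centers h1 h2 hp hq]⟩

theorem thickness_nonneg (V : Set S2) : 0 ≤ thickness V := by
  unfold thickness
  rw [lune_thicknesses]
  apply Real.sInf_nonneg
  rintro _ ⟨c, d, -, -, -, -, rfl⟩
  exact Real.arccos_nonneg _

theorem neg_cos_thickness_le {V : Set S2} (hV : (interior V).Nonempty) {c d : S2}
    (hc : (c : E3) ∈ polar V) (hd : (d : E3) ∈ polar V) :
    -Real.cos (thickness V) ≤ ⟪(c : E3), (d : E3)⟫ := by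
  have hb := abs_le.1 (abs_real_inner_le_norm (c : E3) (d : E3))
  rw [norm_coe, norm_coe, one_mul] at hb
  by_cases h1 : c = d
  · rw [h1, inner_coe_self]
    linarith [Real.neg_one_le_cos (thickness V)]
  · have h2 : c ≠ -d := fun h2 => coe_ne_zero d <| eq_zero_of_inner_eq_zero hV fun x hx => by
      have := hc x hx
      rw [h2, coe_neg_sphere, inner_neg_left] at this
      linarith [hd x hx]
    have hle : thickness V ≤ Real.arccos (-⟪(c : E3), (d : E3)⟫) := by
      unfold thickness
      rw [lune_thicknesses]
      refine csInf_le ⟨0, ?_⟩ ⟨c, d, h1, h2, hc, hd, rfl⟩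
      rintro _ ⟨c, d, -, -, -, -, rfl⟩
      exact Real.arccos_nonneg _
    have := Real.cos_le_cos_of_nonneg_of_le_pi (thickness_nonneg V) (Real.arccos_le_pi _) hle
    rw [Real.cos_arccos (by linarith) (by linarith)] at this
    linarith

theorem mul_norm_le_inner {V : Set S2} {k : ℝ}
    (h : ∀ c d : S2, (c : E3) ∈ polar V → (d : E3) ∈ polar V → k ≤ ⟪(c : E3), (d : E3)⟫)
    {u v : E3} (hu : u ∈ polar V) (hv : v ∈ polar V) : k * (‖u‖ * ‖v‖) ≤ ⟪u, v⟫ := by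
  by_cases hu0 : u = 0
  · rw [hu0]; simp
  by_cases hv0 : v = 0
  · rw [hv0]; simp
  have hdir : ∀ {w : E3} (hw0 : w ≠ 0), w ∈ polar V → (direction w hw0 : E3) ∈ polar V := by
    intro w hw0 hw x hx
    simp only [direction, inner_smul_left, conj_trivial]
    exact mul_nonneg (inv_nonneg.2 (norm_nonneg _)) (hw x hx)
  have e : ⟪u, v⟫ = ⟪(direction u hu0 : E3), (direction v hv0 : E3)⟫ * (‖u‖ * ‖v‖) := by
    conv_lhs => rw [← norm_smul_direction hu0, ← norm_smul_direction hv0]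
    rw [inner_smul_left, inner_smul_right, conj_trivial]
    ring
  rw [e]
  exact mul_le_mul_of_nonneg_right (h _ _ (hdir hu0 hu) (hdir hv0 hv)) (by positivity)

/-- The first order condition for a pair that minimizes the inner product on the polar cone. -/
theorem first_order {V : Set S2} {k : ℝ} (hk : k ≤ 0)
    (h : ∀ c d : S2, (c : E3) ∈ polar V → (d : E3) ∈ polar V → k ≤ ⟪(c : E3), (d : E3)⟫)
    {c d : S2} (hc : (c : E3) ∈ polar V) (hd : (d : E3) ∈ polar V) (hcd : ⟪(c : E3), (d : E3)⟫ = k)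
    {e : E3} (he : e ∈ polar V) : 0 ≤ ⟪e, (d : E3) - k • (c : E3)⟫ := by
  rw [inner_sub_right, inner_smul_right]
  -- Replace `c` by `c + t e`, bound its norm by `√(1 + s) ≤ 1 + s / 2`, and divide by `t`.
  have key : ∀ t : ℝ, 0 < t → k * (t * ⟪e, e⟫ / 2) ≤ ⟪e, (d : E3)⟫ - k * ⟪e, (c : E3)⟫ := by
    intro t ht
    have hu : (c : E3) + t • e ∈ polar V := fun x hx => by
      rw [inner_add_left, inner_smul_left, conj_trivial]
      exact add_nonneg (hc x hx) (mul_nonneg ht.le (he x hx))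
    have h1 := mul_norm_le_inner h hu hd
    rw [norm_coe, mul_one, inner_add_left, inner_smul_left, conj_trivial, hcd] at h1
    have h2 : ‖(c : E3) + t • e‖ ^ 2 = 1 + 2 * t * ⟪e, (c : E3)⟫ + t ^ 2 * ⟪e, e⟫ := by
      rw [← real_inner_self_eq_norm_sq]
      simp only [inner_add_left, inner_add_right, inner_smul_left, inner_smul_right, conj_trivial,
        inner_coe_self, real_inner_comm e (c : E3)]
      ring
    have h3 : ‖(c : E3) + t • e‖ ≤ 1 + t * ⟪e, (c : E3)⟫ + t ^ 2 * ⟪e, e⟫ / 2 := by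
      nlinarith [sq_nonneg (‖(c : E3) + t • e‖ - 1)]
    have h4 := mul_le_mul_of_nonpos_left h3 hk
    refine le_of_mul_le_mul_left ?_ ht
    linarith
  by_contra hcon
  push Not at hcon
  set b := ⟪e, (d : E3)⟫ - k * ⟪e, (c : E3)⟫
  have hee : 0 ≤ ⟪e, e⟫ := real_inner_self_nonneg
  have hden : 0 < -k * ⟪e, e⟫ + 1 := by
    have := mul_nonneg (neg_nonneg.2 hk) hee; linarith
  have ht : 0 < -b / (-k * ⟪e, e⟫ + 1) := div_pos (by linarith) hden
  have := key _ ht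
  have h5 : -b / (-k * ⟪e, e⟫ + 1) * (-k * ⟪e, e⟫ + 1) = -b := div_mul_cancel₀ _ hden.ne'
  nlinarith

theorem exists_inner_lt {R V : Set S2} (hRV : R ⊆ V) (h : thickness R < thickness V)
    (hV : thickness V ≤ Real.pi / 2) :
    ∃ c d : S2, (c : E3) ∈ polar R ∧ (d : E3) ∈ polar R ∧
      ⟪(c : E3), (d : E3)⟫ < -Real.cos (thickness V) := by
  have hne : {δ | ∃ L : Set S2, IsLuneOfThickness L δ ∧ R ⊆ L}.Nonempty := by
    by_contra hcon
    rw [Set.not_nonempty_iff_eq_empty] at hcon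
    have : {δ | ∃ L : Set S2, IsLuneOfThickness L δ ∧ V ⊆ L} = ∅ := by
      rw [Set.eq_empty_iff_forall_notMem] at hcon ⊢
      rintro δ ⟨L, hL, hVL⟩
      exact hcon δ ⟨L, hL, hRV.trans hVL⟩
    -- Without any lune the infimum defaults to `0`, which cannot exceed the thickness of `R`.
    have h2 : thickness V = 0 := by rw [thickness, this, Real.sInf_empty]
    linarith [thickness_nonneg R]
  obtain ⟨δ, hδ, hlt⟩ := exists_lt_of_csInf_lt hne h
  rw [lune_thicknesses] at hδ
  obtain ⟨c, d, -, -, hc, hd, rfl⟩ := hδ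
  refine ⟨c, d, hc, hd, ?_⟩
  have hb := abs_le.1 (abs_real_inner_le_norm (c : E3) (d : E3))
  rw [norm_coe, norm_coe, one_mul] at hb
  have := Real.cos_lt_cos_of_nonneg_of_le_pi (Real.arccos_nonneg _)
    (by linarith [Real.pi_pos]) hlt
  rw [Real.cos_arccos (by linarith) (by linarith)] at this
  linarith

end SphericalPolygon

/-! ### Trimming a vertex of a reduced polygon. -/

namespace SphericalPolygon

open InnerProductGeometry

theorem polar_central (K : Set E3) : polar (central K) = {e | ∀ y ∈ K, 0 ≤ ⟪e, y⟫} := by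
  ext e
  constructor
  · intro h y hy
    by_cases hy0 : y = 0
    · rw [hy0, inner_zero_right]
    rw [← norm_smul_direction hy0, inner_smul_right]
    refine mul_nonneg (norm_nonneg _) (h _ ⟨‖y‖, norm_pos_iff.2 hy0, ?_⟩)
    rwa [norm_smul_direction]
  · rintro h x ⟨r, hr, hx⟩
    have := h _ hx
    rw [inner_smul_right] at this
    exact nonneg_of_mul_nonneg_right this hr

theorem le_inner_of_mem_convexHull {G : Set E3} {e : E3} {m : ℝ} (h : ∀ g ∈ G, m ≤ ⟪e, g⟫) {y : E3}
    (hy : y ∈ convexHull ℝ G) : m ≤ ⟪e, y⟫ :=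
  convexHull_min (t := {y | m ≤ ⟪e, y⟫}) h
    (convex_halfSpace_ge (innerSL ℝ e).toLinearMap.isLinear m) hy

theorem lt_inner_of_mem_convexHull {G : Set E3} {e : E3} {m : ℝ} (h : ∀ g ∈ G, m < ⟪e, g⟫) {y : E3}
    (hy : y ∈ convexHull ℝ G) : m < ⟪e, y⟫ :=
  convexHull_min (t := {y | m < ⟪e, y⟫}) h
    (convex_halfSpace_gt (innerSL ℝ e).toLinearMap.isLinear m) hy

theorem mem_polar_convexHull {G : Set E3} {e : E3} :
    e ∈ polar (central (convexHull ℝ G)) ↔ ∀ g ∈ G, 0 ≤ ⟪e, g⟫ := by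
  rw [polar_central]
  exact ⟨fun h g hg => h g (subset_convexHull ℝ G hg), fun h y hy =>
    le_inner_of_mem_convexHull h hy⟩

theorem span_eq_top_of_inner {G : Set E3} (h : ∀ n : E3, (∀ g ∈ G, ⟪n, g⟫ = 0) → n = 0) :
    Submodule.span ℝ G = ⊤ := by
  rw [← Submodule.orthogonal_eq_bot_iff, Submodule.eq_bot_iff]
  intro n hn
  refine h n fun g hg => ?_
  rw [real_inner_comm]
  exact (Submodule.mem_orthogonal _ _).1 hn g (Submodule.subset_span hg)

/-- The generators obtained by moving the vertex `w` towards the remaining vertices. -/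
def cutoff (F : Set E3) (w : E3) (ε : ℝ) : Set E3 := F ∪ (fun g => w + ε • g) '' F

section

variable {F : Set E3} {w : S2} {ε : ℝ}

theorem mem_convexHull_image {y : E3} (hy : y ∈ convexHull ℝ ((fun g => (w : E3) + ε • g) '' F)) :
    ∃ v ∈ convexHull ℝ F, y = (w : E3) + ε • v := by
  have := convexHull_min (Set.image_mono (subset_convexHull ℝ F))
    ((convex_convexHull ℝ F).affinity (w : E3) ε) hy
  obtain ⟨v, hv, e⟩ := this
  exact ⟨v, hv, e.symm⟩

theorem mem_convexHull_cutoff (hne : F.Nonempty) {y : E3}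
    (hy : y ∈ convexHull ℝ (cutoff F w ε)) :
    ∃ a b : ℝ, 0 ≤ a ∧ 0 ≤ b ∧ a + b = 1 ∧ ∃ u ∈ convexHull ℝ F, ∃ v ∈ convexHull ℝ F,
      (w : E3) + ε • v ∈ convexHull ℝ (cutoff F w ε) ∧ y = a • u + b • ((w : E3) + ε • v) := by
  rw [cutoff, convexHull_union hne (hne.image _), mem_convexJoin] at hy
  obtain ⟨u, hu, v', hv', a, b, ha, hb, hab, rfl⟩ := hy
  obtain ⟨v, hv, rfl⟩ := mem_convexHull_image hv'
  exact ⟨a, b, ha, hb, hab, u, hu, v, hv, convexHull_mono Set.subset_union_right hv', rfl⟩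

theorem mem_convexHull_cutoff_cone (hε : 0 < ε) (hne : F.Nonempty) {y : E3}
    (hy : y ∈ convexHull ℝ (cutoff F w ε)) :
    ∃ b s : ℝ, 0 ≤ b ∧ 0 < s ∧ ∃ u ∈ convexHull ℝ F, y = b • (w : E3) + s • u := by
  obtain ⟨a, b, ha, hb, hab, u, hu, v, hv, -, rfl⟩ := mem_convexHull_cutoff hne hy
  have hs : 0 < a + b * ε := by
    rcases hb.eq_or_lt with h | h
    · rw [← h] at hab ⊢; linarith
    · positivity
  obtain ⟨z, hz, e⟩ := smul_add_smul_mem (convex_convexHull ℝ F) hu hv ha (mul_nonneg hb hε.le) hs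
  refine ⟨b, _, hb, hs, z, hz, ?_⟩
  rw [← e, smul_add, smul_smul]
  abel

theorem smul_add_smul_mem_insert {b s : ℝ} (hb : 0 ≤ b) (hs : 0 < s) {u : E3}
    (hu : u ∈ convexHull ℝ F) :
    ∃ z ∈ convexHull ℝ (insert (w : E3) F), b • (w : E3) + s • u = (b + s) • z :=
  smul_add_smul_mem (convex_convexHull ℝ _) (subset_convexHull ℝ _ (Set.mem_insert _ _))
    (convexHull_mono (Set.subset_insert _ _) hu) hb hs.le (by linarith)

variable (hne : F.Nonempty) (h0 : (0 : E3) ∉ convexHull ℝ (insert (w : E3) F)) (hε : 0 < ε)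
include hne h0 hε

theorem zero_notMem_cutoff : (0 : E3) ∉ convexHull ℝ (cutoff F w ε) := fun h => by
  obtain ⟨b, s, hb, hs, u, hu, e⟩ := mem_convexHull_cutoff_cone hε hne h
  obtain ⟨z, hz, e'⟩ := smul_add_smul_mem_insert (w := w) hb hs hu
  rw [← e] at e'
  rw [(smul_eq_zero.1 e'.symm).resolve_left (by linarith)] at hz
  exact h0 hz

omit h0 in
theorem central_cutoff_subset :
    central (convexHull ℝ (cutoff F w ε)) ⊆ central (convexHull ℝ (insert (w : E3) F)) := by
  rintro x ⟨r, hr, hx⟩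
  obtain ⟨b, s, hb, hs, u, hu, e⟩ := mem_convexHull_cutoff_cone hε hne hx
  obtain ⟨z, hz, e'⟩ := smul_add_smul_mem_insert (w := w) hb hs hu
  have hbs : 0 < b + s := by linarith
  refine ⟨(b + s)⁻¹ * r, by positivity, ?_⟩
  rwa [mul_smul, e, e', smul_smul, inv_mul_cancel₀ hbs.ne', one_smul]

/-- A multiple `r w = b w + s u` puts `w` into the projected hull of `F` if `r > b`, and the origin
into the full hull if `r ≤ b`. -/
theorem notMem_central_cutoff (hw : w ∉ central (convexHull ℝ F)) :
    w ∉ central (convexHull ℝ (cutoff F w ε)) := by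
  rintro ⟨r, hr, hx⟩
  obtain ⟨b, s, hb, hs, u, hu, e⟩ := mem_convexHull_cutoff_cone hε hne hx
  rcases lt_or_ge b r with h | h
  · refine hw ⟨s⁻¹ * (r - b), mul_pos (inv_pos.2 hs) (by linarith), ?_⟩
    have : (r - b) • (w : E3) = s • u := by rw [sub_smul, e, add_sub_cancel_left]
    rwa [mul_smul, this, smul_smul, inv_mul_cancel₀ hs.ne', one_smul]
  · obtain ⟨z, hz, e'⟩ := smul_add_smul_mem_insert (w := w) (sub_nonneg.2 h) hs hu
    have : (b - r) • (w : E3) + s • u = 0 := by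
      rw [sub_smul, sub_add_eq_add_sub, ← e, sub_self]
    rw [this] at e'
    rw [(smul_eq_zero.1 e'.symm).resolve_left (by linarith)] at hz
    exact h0 hz

omit hε in
theorem isConvexBody_cutoff (hε : 0 < ε) (hF : F.Finite)
    (hV : (interior (central (convexHull ℝ (insert (w : E3) F)))).Nonempty) :
    IsConvexBody (central (convexHull ℝ (cutoff F w ε))) := by
  have hz := zero_notMem_cutoff hne h0 hε
  have hfin : (cutoff F w ε).Finite := hF.union (hF.image _)
  refine ⟨isClosed_central (hfin.isCompact_convexHull ℝ) hz,
    isConvex_central (convex_convexHull ℝ _) hz,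
    interior_central_nonempty (span_eq_top_of_inner fun n hn => ?_) (hne.mono Set.subset_union_left)⟩
  have hnF : ∀ g ∈ F, ⟪n, g⟫ = 0 := fun g hg => hn g (Or.inl hg)
  have hnw : ⟪n, (w : E3)⟫ = 0 := by
    obtain ⟨g, hg⟩ := hne
    have := hn _ (Or.inr ⟨g, hg, rfl⟩)
    rwa [inner_add_right, inner_smul_right, hnF g hg, mul_zero, add_zero] at this
  refine eq_zero_of_inner_eq_zero hV fun x hx => ?_
  have h1 : n ∈ polar (central (convexHull ℝ (insert (w : E3) F))) := by
    rw [mem_polar_convexHull]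
    rintro g (rfl | hg)
    exacts [hnw.ge, (hnF g hg).ge]
  have h2 : -n ∈ polar (central (convexHull ℝ (insert (w : E3) F))) := by
    rw [mem_polar_convexHull]
    rintro g (rfl | hg) <;> rw [inner_neg_left]
    exacts [by rw [hnw, neg_zero], by rw [hnF g hg, neg_zero]]
  have h3 := h1 x hx
  have h4 := h2 x hx
  rw [inner_neg_left] at h4
  linarith

end

theorem exists_min_pair {R : Set S2} {m : ℝ}
    (h : ∃ c d : S2, (c : E3) ∈ polar R ∧ (d : E3) ∈ polar R ∧ ⟪(c : E3), (d : E3)⟫ < m) :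
    ∃ c d : S2, (c : E3) ∈ polar R ∧ (d : E3) ∈ polar R ∧ ⟪(c : E3), (d : E3)⟫ < m ∧
      ∀ c' d' : S2, (c' : E3) ∈ polar R → (d' : E3) ∈ polar R →
        ⟪(c : E3), (d : E3)⟫ ≤ ⟪(c' : E3), (d' : E3)⟫ := by
  have hcl : IsClosed {c : S2 | (c : E3) ∈ polar R} := by
    have : {c : S2 | (c : E3) ∈ polar R} = ⋂ x ∈ R, {c : S2 | 0 ≤ ⟪(c : E3), (x : E3)⟫} := by
      ext c; simp [polar]
    rw [this]
    exact isClosed_biInter fun x _ => isClosed_le continuous_const (by fun_prop)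
  obtain ⟨c0, d0, hc0, hd0, hlt⟩ := h
  obtain ⟨⟨c, d⟩, ⟨hc, hd⟩, hmin⟩ := (hcl.prod hcl).isCompact.exists_isMinOn
    (f := fun z : S2 × S2 => ⟪(z.1 : E3), (z.2 : E3)⟫) ⟨(c0, d0), hc0, hd0⟩ (by fun_prop)
  have hmin : ∀ c' d' : S2, (c' : E3) ∈ polar R → (d' : E3) ∈ polar R →
      ⟪(c : E3), (d : E3)⟫ ≤ ⟪(c' : E3), (d' : E3)⟫ := fun c' d' hc' hd' =>
    hmin (show (c', d') ∈ _ from ⟨hc', hd'⟩)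
  exact ⟨c, d, hc, hd, (hmin _ _ hc0 hd0).trans_lt hlt, hmin⟩

section

variable {F : Set E3} {w : S2} (hne : F.Nonempty) (hF : F.Finite)
  (h0 : (0 : E3) ∉ convexHull ℝ (insert (w : E3) F)) (hw : w ∉ central (convexHull ℝ F))
  (hV : IsReduced (central (convexHull ℝ (insert (w : E3) F))))
  (hthick : thickness (central (convexHull ℝ (insert (w : E3) F))) ≤ Real.pi / 2)
include hne hF h0 hw hV hthick

/-- The optimal lune of the trimmed body is too thin to contain the polygon, so one pole, named `c`,
is negative at `w`. Being nonnegative at `w + ε g`, it is positive on `F`; hence the contact point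
on its side involves only the new generators. -/
theorem exists_pair_cutoff {ε : ℝ} (hε : 0 < ε) :
    ∃ c d : S2, (c : E3) ∈ polar (central (convexHull ℝ (cutoff F w ε))) ∧
      (d : E3) ∈ polar (central (convexHull ℝ (cutoff F w ε))) ∧
      ⟪(c : E3), (d : E3)⟫
        < -Real.cos (thickness (central (convexHull ℝ (insert (w : E3) F)))) ∧
      ∃ r : ℝ, 0 < r ∧ ∃ v ∈ convexHull ℝ F,
        (d : E3) - ⟪(c : E3), (d : E3)⟫ • (c : E3) = r • ((w : E3) + ε • v) := by
  have hb := isConvexBody_cutoff hne h0 hε hF hV.1.2.2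
  have hRV := central_cutoff_subset (w := w) hne hε
  have hz := zero_notMem_cutoff hne h0 hε
  have hwV : w ∈ central (convexHull ℝ (insert (w : E3) F)) :=
    mem_central_of_mem (subset_convexHull ℝ _ (Set.mem_insert _ _))
  have hlt := hV.2 _ hb ⟨hRV, fun h => notMem_central_cutoff hne h0 hε hw (h hwV)⟩
  have hC0 := Real.cos_nonneg_of_neg_pi_div_two_le_of_le
    (by linarith [thickness_nonneg (central (convexHull ℝ (insert (w : E3) F))), Real.pi_pos])
    hthick
  obtain ⟨c, d, hc, hd, hcd, hmin, hcV⟩ : ∃ c d : S2,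
      (c : E3) ∈ polar (central (convexHull ℝ (cutoff F w ε))) ∧
      (d : E3) ∈ polar (central (convexHull ℝ (cutoff F w ε))) ∧ ⟪(c : E3), (d : E3)⟫
        < -Real.cos (thickness (central (convexHull ℝ (insert (w : E3) F)))) ∧
      (∀ c' d' : S2, (c' : E3) ∈ polar (central (convexHull ℝ (cutoff F w ε))) →
        (d' : E3) ∈ polar (central (convexHull ℝ (cutoff F w ε))) →
        ⟪(c : E3), (d : E3)⟫ ≤ ⟪(c' : E3), (d' : E3)⟫) ∧
      (c : E3) ∉ polar (central (convexHull ℝ (insert (w : E3) F))) := by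
    obtain ⟨c, d, hc, hd, hcd, hmin⟩ := exists_min_pair (exists_inner_lt hRV hlt hthick)
    by_cases h1 : (c : E3) ∈ polar (central (convexHull ℝ (insert (w : E3) F)))
    · refine ⟨d, c, hd, hc, by rwa [real_inner_comm], by rwa [real_inner_comm], fun h2 => ?_⟩
      linarith [neg_cos_thickness_le hV.1.2.2 h1 h2]
    · exact ⟨c, d, hc, hd, hcd, hmin, h1⟩
  refine ⟨c, d, hc, hd, hcd, ?_⟩
  rw [mem_polar_convexHull] at hc hd hcV
  have hcw : ⟪(c : E3), (w : E3)⟫ < 0 := by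
    by_contra hcon
    push Not at hcon
    refine hcV ?_
    rintro g (rfl | hg)
    exacts [hcon, hc g (Or.inl hg)]
  have hcF : ∀ g ∈ F, 0 < ⟪(c : E3), g⟫ := fun g hg => by
    have := hc _ (Or.inr ⟨g, hg, rfl⟩)
    rw [inner_add_right, inner_smul_right] at this
    exact pos_of_mul_pos_right (by linarith : 0 < ε * _) hε.le
  set k := ⟪(c : E3), (d : E3)⟫ with hk
  have hk0 : k < 0 := by linarith
  have hx0 : (d : E3) - k • (c : E3) ≠ 0 := fun h => by
    obtain ⟨g, hg⟩ := hne
    have h1 := congrArg (fun v => ⟪v, g⟫) h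
    simp only [inner_sub_left, inner_smul_left, conj_trivial, inner_zero_left] at h1
    have h2 := mul_pos (neg_pos.2 hk0) (hcF g hg)
    linarith [hd g (Or.inl hg)]
  obtain ⟨r, hr, y, hy, e⟩ := exists_smul_of_bidual
    ((hF.union (hF.image _)).isCompact_convexHull ℝ : IsCompact (convexHull ℝ (cutoff F w ε)))
    (convex_convexHull ℝ _) hz hx0 fun e he =>
      first_order hk0.le hmin (mem_polar_convexHull.2 hc) (mem_polar_convexHull.2 hd) hk.symm
        (by rw [polar_central]; exact he)
  refine ⟨r, hr, ?_⟩
  obtain ⟨a, b, ha, hb, hab, u, hu, v, hv, hvK, rfl⟩ := mem_convexHull_cutoff hne hy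
  have hcx : ⟪(c : E3), (d : E3) - k • (c : E3)⟫ = 0 := by
    rw [inner_sub_right, inner_smul_right, inner_coe_self, ← hk]; ring
  rw [e, inner_smul_right, inner_add_right, inner_smul_right, inner_smul_right] at hcx
  have h1 : 0 < ⟪(c : E3), u⟫ := lt_inner_of_mem_convexHull hcF hu
  have h2 : 0 ≤ ⟪(c : E3), (w : E3) + ε • v⟫ :=
    le_inner_of_mem_convexHull hc hvK
  have h3 := (mul_eq_zero.1 hcx).resolve_left hr.ne'
  have h4 := mul_nonneg hb h2
  have h5 := mul_nonneg ha h1.le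
  have ha0 : a = 0 := (mul_eq_zero.1 (by linarith : a * ⟪(c : E3), u⟫ = 0)).resolve_right h1.ne'
  rw [ha0, zero_add] at hab
  exact ⟨v, hv, by rw [e, ha0, hab, zero_smul, one_smul, zero_add]⟩

theorem exists_limit_pair :
    ∃ c d : S2, (c : E3) ∈ polar (central (convexHull ℝ (insert (w : E3) F))) ∧
      (d : E3) ∈ polar (central (convexHull ℝ (insert (w : E3) F))) ∧
      ⟪(c : E3), (d : E3)⟫
        = -Real.cos (thickness (central (convexHull ℝ (insert (w : E3) F)))) ∧
      (d : E3) + Real.cos (thickness (central (convexHull ℝ (insert (w : E3) F)))) • (c : E3)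
        = Real.sin (thickness (central (convexHull ℝ (insert (w : E3) F)))) • (w : E3) := by
  have hex := fun n : ℕ => exists_pair_cutoff hne hF h0 hw hV hthick
    (ε := 1 / ((n : ℝ) + 1)) (by positivity)
  have hΔ0 := thickness_nonneg (central (convexHull ℝ (insert (w : E3) F)))
  have hF1 := fun {c d} => neg_cos_thickness_le hV.1.2.2 (c := c) (d := d)
  set Δ := thickness (central (convexHull ℝ (insert (w : E3) F)))
  choose c d hc hd hcd r hr v hv e using hex
  obtain ⟨⟨c₀, d₀⟩, φ, hφ, hlim⟩ := CompactSpace.tendsto_subseq fun n => (c n, d n)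
  have hlc : Filter.Tendsto (fun n => (c (φ n) : E3)) Filter.atTop (nhds (c₀ : E3)) :=
    (continuous_subtype_val.comp continuous_fst).continuousAt.tendsto.comp hlim
  have hld : Filter.Tendsto (fun n => (d (φ n) : E3)) Filter.atTop (nhds (d₀ : E3)) :=
    (continuous_subtype_val.comp continuous_snd).continuousAt.tendsto.comp hlim
  have hε : Filter.Tendsto (fun n => 1 / ((φ n : ℝ) + 1)) Filter.atTop (nhds 0) :=
    tendsto_one_div_add_atTop_nhds_zero_nat.comp hφ.tendsto_atTop
  have hpol : ∀ {f : ℕ → S2} {f₀ : S2},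
      (∀ n : ℕ, (f n : E3) ∈ polar (central (convexHull ℝ (cutoff F w (1 / ((n : ℝ) + 1)))))) →
      Filter.Tendsto (fun n => (f (φ n) : E3)) Filter.atTop (nhds (f₀ : E3)) →
      (f₀ : E3) ∈ polar (central (convexHull ℝ (insert (w : E3) F))) := by
    intro f f₀ hf hl
    have hf := fun n => mem_polar_convexHull.1 (hf n)
    rw [mem_polar_convexHull]
    rintro g (rfl | hg)
    · obtain ⟨g, hg⟩ := hne
      have h1 : Filter.Tendsto (fun n => ⟪(f (φ n) : E3), (w : E3) + (1 / ((φ n : ℝ) + 1)) • g⟫)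
          Filter.atTop (nhds ⟪(f₀ : E3), (w : E3) + (0 : ℝ) • g⟫) :=
        hl.inner (tendsto_const_nhds.add (hε.smul_const g))
      rw [zero_smul, add_zero] at h1
      exact ge_of_tendsto' h1 fun n => hf _ _ (Or.inr ⟨g, hg, rfl⟩)
    · exact ge_of_tendsto' (hl.inner tendsto_const_nhds) fun n => hf _ _ (Or.inl hg)
  have hc₀ := hpol hc hlc
  have hd₀ := hpol hd hld
  have hk := hlc.inner (𝕜 := ℝ) hld
  have hk₀ : ⟪(c₀ : E3), (d₀ : E3)⟫ = -Real.cos Δ :=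
    le_antisymm (le_of_tendsto' hk fun n => (hcd _).le) (hF1 hc₀ hd₀)
  refine ⟨c₀, d₀, hc₀, hd₀, hk₀, ?_⟩
  obtain ⟨B, hB⟩ := (hF.isCompact_convexHull ℝ).isBounded.exists_norm_le
  have hy : Filter.Tendsto (fun n => (w : E3) + (1 / ((φ n : ℝ) + 1)) • v (φ n)) Filter.atTop
      (nhds (w : E3)) := by
    have : Filter.Tendsto (fun n => (1 / ((φ n : ℝ) + 1)) • v (φ n)) Filter.atTop (nhds 0) :=
      hε.zero_smul_isBoundedUnder_le (Filter.isBoundedUnder_of ⟨B, fun n => hB _ (hv _)⟩)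
    simpa using (tendsto_const_nhds (x := (w : E3))).add this
  have hx := hld.sub (hk.smul hlc)
  have hlim1 := hy.norm.smul hx
  have hlim2 := hx.norm.smul hy
  -- The multipliers `r n` are not controlled in advance; multiplying each side by the norm of the
  -- other eliminates them before passing to the limit.
  have heq := tendsto_nhds_unique (hlim1.congr fun n => by
    rw [e, smul_smul, norm_smul, Real.norm_eq_abs, abs_of_pos (hr _), mul_comm]) hlim2
  have hn := inner_sub_smul_self c₀ d₀
  rw [norm_coe, one_smul] at heq
  rw [real_inner_self_eq_norm_sq] at hn
  rw [hk₀] at heq hn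
  rw [neg_smul, sub_neg_eq_add] at heq hn
  rw [heq]
  congr 1
  rw [← Real.sqrt_sq (norm_nonneg _), hn, neg_sq, ← Real.sin_sq]
  exact Real.sqrt_sq (Real.sin_nonneg_of_nonneg_of_le_pi hΔ0 (by linarith [Real.pi_pos]))

end

end SphericalPolygon

/-! ### From vertices to the polygon, and the chord at a vertex. -/

namespace SphericalPolygon

open InnerProductGeometry

/-- Points of the hull have norm at most one, so normalizing them can only increase a nonnegative
inner product. -/
theorem le_inner_of_mem_central {G : Set E3} (hG : ∀ g ∈ G, ‖g‖ ≤ 1) {m : ℝ} (hm : 0 ≤ m)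
    (h : ∀ g ∈ G, ∀ g' ∈ G, m ≤ ⟪g, g'⟫) {x y : S2} (hx : x ∈ central (convexHull ℝ G))
    (hy : y ∈ central (convexHull ℝ G)) : m ≤ ⟪(x : E3), (y : E3)⟫ := by
  obtain ⟨r, hr, hx⟩ := hx
  obtain ⟨s, hs, hy⟩ := hy
  have hn : ∀ {r : ℝ} {x : S2}, 0 < r → r • (x : E3) ∈ convexHull ℝ G → r ≤ 1 := by
    intro r x hr hx
    have h1 := convexHull_min (t := Metric.closedBall (0 : E3) 1)
      (fun g hg => mem_closedBall_zero_iff.2 (hG g hg)) (convex_closedBall _ _) hx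
    rwa [mem_closedBall_zero_iff, norm_smul, norm_coe, mul_one, Real.norm_eq_abs,
      abs_of_pos hr] at h1
  have h1 : m ≤ ⟪r • (x : E3), s • (y : E3)⟫ := le_inner_of_mem_convexHull (fun g hg => by
    rw [real_inner_comm]
    exact le_inner_of_mem_convexHull (h g hg) hx) hy
  rw [inner_smul_left, inner_smul_right, conj_trivial, ← mul_assoc] at h1
  have hrs : 0 < r * s := mul_pos hr hs
  have h2 : r * s ≤ 1 := mul_le_one₀ (hn hr hx) hs.le (hn hs hy)
  have h3 : 0 ≤ ⟪(x : E3), (y : E3)⟫ := nonneg_of_mul_nonneg_right (hm.trans h1) hrs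
  exact h1.trans (mul_le_of_le_one_left h3 h2)

theorem diam_le_arccos {V : Set S2} (hV : V.Nonempty) {m : ℝ}
    (h : ∀ x ∈ V, ∀ y ∈ V, m ≤ ⟪(x : E3), (y : E3)⟫) : diam V ≤ Real.arccos m := by
  obtain ⟨x, hx⟩ := hV
  refine csSup_le ⟨_, x, hx, x, hx, rfl⟩ ?_
  rintro _ ⟨x, hx, y, hy, rfl⟩
  rw [sdist_eq_arccos]
  exact Real.arccos_le_arccos (h x hx y hy)

theorem sdist_le_diam {V : Set S2} {x y : S2} (hx : x ∈ V) (hy : y ∈ V) : sdist x y ≤ diam V := by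
  refine le_csSup ⟨Real.pi, ?_⟩ ⟨x, hx, y, hy, rfl⟩
  rintro _ ⟨x, -, y, -, rfl⟩
  exact angle_le_pi _ _

/-- A reduced polygon, its thickness being at most `π / 2`, has a chord at each of its vertices. -/
theorem exists_chord {P : Finset S2} (hcard : 3 ≤ P.card) {D : Set S2} (hD : IsConvex D)
    (hPD : (P : Set S2) ⊆ D) (hvert : ∀ p ∈ P, p ∉ hull ((P : Set S2) \ {p})) {V : Set S2}
    (hVP : V = hull (P : Set S2)) (hred : IsReduced V) (hthick : thickness V ≤ Real.pi / 2) {w : S2}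
    (hw : w ∈ P) : 0 < Real.sin (thickness V) ∧
      ∃ a : Chord (P.map (Function.Embedding.subtype _)) (Real.cos (thickness V))
        (Real.sin (thickness V)), a.p = (w : E3) := by
  set F : Set E3 := (↑) '' ((P : Set S2) \ {w}) with hF
  have hFP : insert (w : E3) F = (↑) '' (P : Set S2) := by
    rw [hF, ← Set.image_insert_eq, Set.insert_sdiff_singleton, Set.insert_eq_of_mem hw]
  have hV : V = central (convexHull ℝ (insert (w : E3) F)) := by
    rw [hVP, hull_eq_central hD hPD, hFP]
  have h0 : (0 : E3) ∉ convexHull ℝ (insert (w : E3) F) := by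
    rw [hFP]; exact zero_notMem_convexHull hD hPD
  have hwF : w ∉ central (convexHull ℝ F) := by
    rw [hF, ← hull_eq_central hD (Set.sdiff_subset.trans hPD)]
    exact hvert w hw
  have hfin : F.Finite := (P.finite_toSet.sdiff).image _
  have hne : F.Nonempty := by
    obtain ⟨x, hx, hxw⟩ := Finset.exists_mem_ne (by omega : 1 < P.card) w
    exact ⟨x, x, ⟨hx, hxw⟩, rfl⟩
  have hpol : polar V = dualCone (P.map (Function.Embedding.subtype _)) := by
    ext e
    rw [hV, mem_polar_convexHull, hFP]
    simp [dualCone]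
  have hΔ0 := thickness_nonneg V
  have hF1 := fun c d => neg_cos_thickness_le hred.1.2.2 (c := c) (d := d)
  rw [hV] at hred hthick
  obtain ⟨c', d', -, -, hlt, -⟩ := exists_pair_cutoff hne hfin h0 hwF hred hthick one_pos
  obtain ⟨c, d, hc, hd, hcd, e⟩ := exists_limit_pair hne hfin h0 hwF hred hthick
  rw [← hV] at hlt hcd e hthick hc hd
  have hC0 := Real.cos_nonneg_of_neg_pi_div_two_le_of_le (by linarith [Real.pi_pos]) hthick
  have hCS := Real.cos_sq_add_sin_sq (thickness V)
  -- Thickness zero would give a trimmed body two unit poles with inner product below `-1`.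
  have hS : 0 < Real.sin (thickness V) := by
    refine Real.sin_pos_of_pos_of_lt_pi (hΔ0.lt_of_ne fun h => ?_) (by linarith [Real.pi_pos])
    rw [← h, Real.cos_zero] at hlt
    have hb := (abs_le.1 (abs_real_inner_le_norm (c' : E3) (d' : E3))).1
    rw [norm_coe, norm_coe, one_mul] at hb
    linarith
  refine ⟨hS, ?_⟩
  -- The limit construction places only `p = w` in the polygon; for `q` the first order condition
  -- with `c` and `d` exchanged is needed.
  have hqe : ∀ e ∈ polar V, 0 ≤ ⟪e, (c : E3) + Real.cos (thickness V) • (d : E3)⟫ := by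
    intro e he
    have := first_order (neg_nonpos.2 hC0) hF1 hd hc (by rw [real_inner_comm]; exact hcd) he
    rwa [neg_smul, sub_neg_eq_add] at this
  set C := Real.cos (thickness V)
  set S := Real.sin (thickness V)
  have hq : (w : E3) = S⁻¹ • ((d : E3) + C • (c : E3)) := by
    rw [e, smul_smul, inv_mul_cancel₀ hS.ne', one_smul]
  have hS2 : S⁻¹ * S⁻¹ * (1 - C ^ 2) = 1 := by
    rw [show 1 - C ^ 2 = S * S by linarith]; field_simp
  have hSS : S⁻¹ * (1 - C ^ 2) = S := by
    rw [show 1 - C ^ 2 = S * S by linarith]; field_simp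
  have hdc : ⟪(d : E3), (c : E3)⟫ = -C := by rw [real_inner_comm]; exact hcd
  refine ⟨⟨c, d, w, S⁻¹ • ((c : E3) + C • (d : E3)), hpol ▸ hc, hpol ▸ hd, inner_coe_self w, ?_, ?_,
    ?_, ?_, fun e he => he _ (by simpa using hw), fun e he => ?_⟩, rfl⟩
  · simp only [inner_add_left, inner_add_right, inner_smul_left, inner_smul_right, conj_trivial,
      inner_coe_self, hcd, hdc]
    linear_combination hS2
  · rw [hq]
    simp only [inner_add_left, inner_add_right, inner_smul_left, inner_smul_right, conj_trivial,
      inner_coe_self, hcd, hdc]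
    linear_combination C * hS2
  · rw [hq]
    nth_rewrite 1 [← hSS]
    module
  · rw [hq]
    nth_rewrite 1 [← hSS]
    have : S * S⁻¹ = 1 := mul_inv_cancel₀ hS.ne'
    module
  · rw [inner_smul_right]
    exact mul_nonneg (inv_nonneg.2 hS.le) (hqe e (hpol ▸ he))

/-- A chord whose thickness is a right angle joins orthogonal points of the polygon. -/
theorem exists_sdist_eq_pi_div_two {P : Finset S2} {V : Set S2}
    (hV : V = central (convexHull ℝ ((↑) '' (P : Set S2))))
    (h0 : (0 : E3) ∉ convexHull ℝ ((↑) '' (P : Set S2) : Set E3)) {S : ℝ} {w : S2} (hw : w ∈ P)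
    (a : Chord (P.map (Function.Embedding.subtype _)) 0 S) (ha : a.p = (w : E3)) :
    ∃ x ∈ V, ∃ y ∈ V, sdist x y = Real.pi / 2 := by
  have hq0 : a.q ≠ 0 := fun h => by
    have := a.qq
    rw [h, inner_zero_left] at this
    exact zero_ne_one this
  obtain ⟨r, hr, y, hy, e⟩ := exists_smul_of_bidual
    ((P.finite_toSet.image _).isCompact_convexHull ℝ) (convex_convexHull ℝ _) h0 hq0 fun e he =>
      a.hq e fun x hx => he x (subset_convexHull ℝ _ (by simpa using hx))
  refine ⟨w, ?_, ⟨a.q, ?_⟩, ?_, ?_⟩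
  · rw [hV]
    exact mem_central_of_mem (subset_convexHull ℝ _ ⟨w, hw, rfl⟩)
  · rw [mem_sphere_zero_iff_norm]
    exact norm_eq_one a.qq
  · rw [hV]
    refine ⟨r⁻¹, inv_pos.2 hr, ?_⟩
    simp only
    rwa [e, smul_smul, inv_mul_cancel₀ hr.ne', one_smul]
  · rw [sdist_eq_arccos, Real.arccos_eq_pi_div_two, ← ha]
    exact a.pq

end SphericalPolygon

/-! ### The diameter of a reduced polygon. -/

theorem proposition4p4 (V : Set SphericalPolygon.S2)
    (hpoly : SphericalPolygon.IsPolygon V) (hred : SphericalPolygon.IsReduced V)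
    (hthick : SphericalPolygon.thickness V ≤ Real.pi / 2) :
    SphericalPolygon.diam V ≤
        Real.arccos (Real.cos (SphericalPolygon.thickness V) *
          Real.sqrt (1 - Real.sqrt 2 / 2 * Real.sin (SphericalPolygon.thickness V))) ∧
      (SphericalPolygon.diam V =
          Real.arccos (Real.cos (SphericalPolygon.thickness V) *
            Real.sqrt (1 - Real.sqrt 2 / 2 * Real.sin (SphericalPolygon.thickness V))) ↔
        SphericalPolygon.thickness V = Real.pi / 2) := by
  obtain ⟨P, hcard, ⟨D, hD, hPD⟩, hvert, hVP⟩ := hpoly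
  have hch := fun w (hw : w ∈ P) =>
    SphericalPolygon.exists_chord hcard hD hPD hvert hVP hred hthick hw
  obtain ⟨w₀, hw₀⟩ : P.Nonempty := Finset.card_pos.1 (by omega)
  have hS := (hch w₀ hw₀).1
  have hV := SphericalPolygon.hull_eq_central hD hPD
  rw [← hVP] at hV
  have hVne : V.Nonempty := hred.1.2.2.mono interior_subset
  have hΔ0 := SphericalPolygon.thickness_nonneg V
  have hG : ∀ g ∈ ((↑) '' (P : Set SphericalPolygon.S2) : Set SphericalPolygon.E3), ‖g‖ ≤ 1 := by
    rintro _ ⟨x, -, rfl⟩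
    exact (SphericalPolygon.norm_coe x).le
  rcases hthick.lt_or_eq with hlt | heq
  · have hC : 0 < Real.cos (SphericalPolygon.thickness V) :=
      Real.cos_pos_of_mem_Ioo ⟨by linarith [Real.pi_pos], hlt⟩
    have hF : ∀ u ∈ SphericalPolygon.dualCone (P.map (Function.Embedding.subtype _)),
        ∀ v ∈ SphericalPolygon.dualCone (P.map (Function.Embedding.subtype _)),
        inner ℝ u u = inner ℝ v v →
        -Real.cos (SphericalPolygon.thickness V) * inner ℝ u u ≤ inner ℝ u v := by
      have hpol : SphericalPolygon.polar V
          = SphericalPolygon.dualCone (P.map (Function.Embedding.subtype _)) := by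
        ext e
        rw [hV, SphericalPolygon.mem_polar_convexHull]
        simp [SphericalPolygon.dualCone]
      rw [← hpol]
      intro u hu v hv h
      have := SphericalPolygon.mul_norm_le_inner (fun c d =>
        SphericalPolygon.neg_cos_thickness_le hred.1.2.2 (c := c) (d := d)) hu hv
      rw [real_inner_self_eq_norm_sq, real_inner_self_eq_norm_sq,
        sq_eq_sq₀ (norm_nonneg _) (norm_nonneg _)] at h
      rwa [← h, ← sq, ← real_inner_self_eq_norm_sq] at this
    have hk2 : Real.sqrt (1 - Real.sqrt 2 / 2 * Real.sin (SphericalPolygon.thickness V)) ^ 2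
        = 1 - Real.sqrt 2 / 2 * Real.sin (SphericalPolygon.thickness V) := by
      refine Real.sq_sqrt ?_
      have h1 : Real.sqrt 2 ≤ 2 := Real.sqrt_le_iff.2 ⟨by norm_num, by norm_num⟩
      have h2 := mul_le_mul h1 (Real.sin_le_one (SphericalPolygon.thickness V)) hS.le zero_le_two
      linarith
    have hgt := fun v (hv : v ∈ P) w (hw : w ∈ P) =>
      SphericalPolygon.inner_gt hS (Real.cos_sq_add_sin_sq _) hC hF
        (fun x hx => by
          obtain ⟨y, hy, rfl⟩ := Finset.mem_map.1 hx
          exact (hch y hy).2) (Real.sqrt_nonneg _) hk2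
        (Finset.mem_map_of_mem (Function.Embedding.subtype _) hv)
        (Finset.mem_map_of_mem (Function.Embedding.subtype _) hw)
    set b := Real.cos (SphericalPolygon.thickness V) *
      Real.sqrt (1 - Real.sqrt 2 / 2 * Real.sin (SphericalPolygon.thickness V))
    have hb : 0 ≤ b := mul_nonneg hC.le (Real.sqrt_nonneg _)
    -- The minimum over the finitely many pairs of vertices is attained, so the strict bound
    -- survives the supremum in the diameter.
    obtain ⟨⟨v, w⟩, hvw, hmin⟩ := (P ×ˢ P).exists_min_image
      (fun z => inner ℝ (z.1 : SphericalPolygon.E3) (z.2 : SphericalPolygon.E3))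
      ⟨(w₀, w₀), Finset.mem_product.2 ⟨hw₀, hw₀⟩⟩
    obtain ⟨hv, hw⟩ := Finset.mem_product.1 hvw
    have hm := hgt v hv w hw
    have hle : SphericalPolygon.diam V
        ≤ Real.arccos (inner ℝ (v : SphericalPolygon.E3) (w : SphericalPolygon.E3)) := by
      refine SphericalPolygon.diam_le_arccos hVne fun x hx y hy => ?_
      rw [hV] at hx hy
      refine SphericalPolygon.le_inner_of_mem_central hG (hb.trans hm.le) ?_ hx hy
      rintro _ ⟨x, hx, rfl⟩ _ ⟨y, hy, rfl⟩
      exact hmin (x, y) (Finset.mem_product.2 ⟨hx, hy⟩)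
    have hlt' : SphericalPolygon.diam V < Real.arccos b := by
      refine hle.trans_lt (Real.arccos_lt_arccos (by linarith) hm ?_)
      have := real_inner_le_norm (v : SphericalPolygon.E3) (w : SphericalPolygon.E3)
      rwa [SphericalPolygon.norm_coe, SphericalPolygon.norm_coe, one_mul] at this
    exact ⟨hlt'.le, fun h => absurd h hlt'.ne, fun h => absurd h hlt.ne⟩
  · rw [heq, Real.cos_pi_div_two, Real.sin_pi_div_two] at hch
    have hle : SphericalPolygon.diam V ≤ Real.arccos 0 := by
      refine SphericalPolygon.diam_le_arccos hVne fun x hx y hy => ?_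
      rw [hV] at hx hy
      refine SphericalPolygon.le_inner_of_mem_central hG le_rfl ?_ hx hy
      rintro _ ⟨v, hv, rfl⟩ _ ⟨w, hw, rfl⟩
      obtain ⟨a, ha⟩ := (hch v hv).2
      -- For `C = 0` and `S = 1` the pole `a.d` is the vertex `v` itself, so membership in the dual
      -- cone is the wanted inequality.
      have h1 := a.inner_d w
      rw [one_mul, zero_mul, sub_zero, ha] at h1
      rw [← h1]
      exact a.hd w (Finset.mem_map_of_mem (Function.Embedding.subtype _) hw)
    have hge : Real.pi / 2 ≤ SphericalPolygon.diam V := by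
      obtain ⟨a, ha⟩ := (hch w₀ hw₀).2
      obtain ⟨x, hx, y, hy, h⟩ := SphericalPolygon.exists_sdist_eq_pi_div_two hV
        (SphericalPolygon.zero_notMem_convexHull hD hPD) hw₀ a ha
      rw [← h]
      exact SphericalPolygon.sdist_le_diam hx hy
    rw [heq, Real.cos_pi_div_two, zero_mul]
    rw [Real.arccos_zero] at hle ⊢
    exact ⟨hle, fun _ => rfl, fun _ => le_antisymm hle hge⟩
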